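/- A QAC circuit on a finite set of qubits is a product $M_d\cdots M_1$ of $d$ layers (its depth is $d$), where each layer is a product of gates operating on pairwise disjoint sets of qubits and every gate is either an arbitrary single-qubit unitary or a generalized Toffoli gate $|x_1,\dots,x_k\rangle|b\rangle\mapsto|x_1,\dots,x_k\rangle|b\oplus(x_1\wedge\cdots\wedge x_k)\rangle$ with $k\ge 1$. Its size is the total number of its gates plus the number of qubits on which it is defined. For $n\ge1$ let $$|W_n\rangle=\frac1{\sqrt n}\sum_{i=1}^n|e_i\rangle,\qquad e_i=0^{i-1}10^{n-i}.$$ **Theorem.** There are a constant $d\in\mathbb N$ and a polynomial $p$ with coefficients in $\mathbb N$ such that for every $n\ge1$ there are a number $a\le p(n)$ of ancillas and a QAC circuit $U$ on $n+a$ qubits, of depth at most $d$ and size at most $p(n)$, with $$U\,|0^n\rangle|0^a\rangle=|W_n\rangle|0^a\rangle\quad\text{exactly.}$$ -/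

import Mathlib

open scoped Matrix

noncomputable section

/-- Vectors of the state space `(ℂ²)^{⊗ Q}` of a register with set of qubits `Q`, written in
amplitudes over the computational basis `Q → Bool` (`false` is the bit `0`, `true` the bit `1`). -/
abbrev QState (Q : Type*) : Type _ := (Q → Bool) → ℂ

/-- The computational basis state `|x⟩`. -/
def ket {Q : Type*} [DecidableEq Q] [Fintype Q] (x : Q → Bool) : QState Q :=
  Pi.single x 1

/-- The all-zero state `|0^Q⟩`. -/
def zeroState (Q : Type*) [DecidableEq Q] [Fintype Q] : QState Q :=
  ket (fun _ => false)

/-- The product state `|ψ⟩|φ⟩` on the disjoint union of two registers. -/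
def tensorState {P Q : Type*} (ψ : QState P) (φ : QState Q) : QState (P ⊕ Q) :=
  fun x => ψ (fun i => x (Sum.inl i)) * φ (fun j => x (Sum.inr j))

/-- The state `|W⟩ = n^{-1/2} ∑_i |e_i⟩`, where `e_i` is the `n`-bit string whose only `1` is at
position `i`. -/
def wState (n : ℕ) : QState (Fin n) :=
  (((Real.sqrt n)⁻¹ : ℝ) : ℂ) • ∑ i : Fin n, ket (fun j => decide (j = i))

/-- The gates of a `QAC` circuit on the qubits `Q`: an arbitrary single-qubit unitary applied to
any qubit, or a generalized Toffoli gate `|x, b⟩ ↦ |x, b ⊕ AND(x)⟩` with any nonempty set of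
control qubits and any other qubit as its target. -/
inductive QACGate (Q : Type*) where
  | single (q : Q) (u : Matrix.unitaryGroup Bool ℂ) : QACGate Q
  | toffoli (controls : Finset Q) (target : Q) (nonempty : controls.Nonempty)
      (target_notMem : target ∉ controls) : QACGate Q

namespace QACGate

variable {Q : Type*} [DecidableEq Q]

/-- The set of qubits on which a gate operates. -/
def support : QACGate Q → Finset Q
  | single q _ => {q}
  | toffoli controls target _ _ => insert target controls

/-- The action of a generalized Toffoli gate on bit strings. -/
def toffoliFun (controls : Finset Q) (target : Q) (x : Q → Bool) : Q → Bool :=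
  Function.update x target (xor (x target) (decide (∀ c ∈ controls, x c = true)))

/-- The matrix of a gate on the whole register (the gate tensored with the identity on the qubits
on which it does not operate), in the computational basis. -/
def matrix [Fintype Q] : QACGate Q → Matrix (Q → Bool) (Q → Bool) ℂ
  | single q u => Matrix.of fun x y =>
      if ∀ r, r ≠ q → x r = y r then (u : Matrix Bool Bool ℂ) (x q) (y q) else 0
  | toffoli controls target _ _ => Matrix.of fun x y =>
      if x = toffoliFun controls target y then 1 else 0

end QACGate

/-- A layer: finitely many gates that operate on pairwise disjoint sets of qubits. -/
structure QACLayer (Q : Type*) [DecidableEq Q] where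
  gates : List (QACGate Q)
  disjoint : gates.Pairwise fun g h => Disjoint g.support h.support

/-- The product of the gates of a layer. -/
def QACLayer.matrix {Q : Type*} [DecidableEq Q] [Fintype Q] (L : QACLayer Q) :
    Matrix (Q → Bool) (Q → Bool) ℂ :=
  (L.gates.map QACGate.matrix).prod

/-- A `QAC` circuit `M_d ⋯ M_1` on the qubits `Q`, given as the list of its layers
`[M_1, …, M_d]` in the order in which they are applied. -/
structure QACCircuit (Q : Type*) [DecidableEq Q] where
  layers : List (QACLayer Q)

namespace QACCircuit

variable {Q : Type*} [DecidableEq Q]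

/-- The depth: the number of layers. -/
def depth (C : QACCircuit Q) : ℕ := C.layers.length

/-- The size: the number of gates plus the number of qubits (idle qubits included). -/
def size [Fintype Q] (C : QACCircuit Q) : ℕ :=
  (C.layers.map fun L => L.gates.length).sum + Fintype.card Q

/-- The operator `M_d ⋯ M_1` that the circuit implements. -/
def matrix [Fintype Q] (C : QACCircuit Q) : Matrix (Q → Bool) (Q → Bool) ℂ :=
  (C.layers.reverse.map QACLayer.matrix).prod

end QACCircuit

/-- The circuit `C` prepares the `n`-qubit state `ψ` exactly with `a` ancillas:
`C|0^n⟩|0^a⟩ = |ψ⟩|0^a⟩`. -/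
def QACCircuit.Prepares {n a : ℕ} (C : QACCircuit (Fin n ⊕ Fin a)) (ψ : QState (Fin n)) : Prop :=
  C.matrix *ᵥ tensorState (zeroState (Fin n)) (zeroState (Fin a)) =
    tensorState ψ (zeroState (Fin a))

end

/-! Everything rests on exact amplitude amplification (`exists_impl_amplify`). If the good part of
`A|0⟩` has squared norm exactly `1/4`, it has amplitude `sin 30°`, and a single Grover round turns
the angle to `90°`, leaving only the normalized good part. Any good part of known squared norm at
least `1/4` can be brought to exactly `1/4` by also requiring a suitably biased extra qubit to be
`1`.

For `|W_n⟩`, put every qubit in `√(1-1/n)|0⟩ + √(1/n)|1⟩`. Hamming weight one then has probability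
`B = (1-1/n)^(n-1) ≥ 1/4`, uniformly over the strings `e_i`. One round suffices, given a
constant-depth circuit that flips the sign of the strings of weight one.

Such an oracle (`exists_impl_oracle`) uses binary digits. For each digit, take the NOR of the bits
at positions where that digit is `0` and the NOR where it is `1`. The parity of the two is `1` for
every digit exactly when the weight is one (`forall_digitTest_iff`). The `k = O(log n)` tests are to
run in parallel, so each input bit is needed in `k` copies, although fan-out is not a gate.

Copies to logarithmically many qubits come from a balanced state whose `k` targets are always all
equal, with each value having probability `1/2` (`exists_impl_nekomata`). Hadamards around a phase
flip of `0^k` give `|0^k⟩` minus a small multiple of the uniform superposition. Amplification keeps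
only `0^k` and `1^k`, with probability `p = O(4^{-k})` for `1^k` (`exists_impl_biasedCat`). Take
`4^k` such states with `(1-p)^(4^k) = 1/2`, and let target `c` be the NOR of their `c`-th qubits:
all targets agree, and are `1` with probability exactly `1/2`. As `k` is logarithmic, `4^k` is
polynomial in `n`.

If `U` prepares such a state `ν`, balance makes `ν` and `Z_q ν` orthogonal, so `U` can be used to
select the half of `ν` in which the targets equal a given bit (`exists_impl_copy_of_balanced`). This
copying is later undone by the inverse circuit. -/

/-! ### Gates as operators on amplitudes: commutation and inverses. -/

namespace QACGate

variable {Q : Type*} [DecidableEq Q]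

/-- The action of a gate on states. -/
def app : QACGate Q → QState Q → QState Q
  | single q u, ψ => fun x => ∑ b, (u : Matrix Bool Bool ℂ) (x q) b * ψ (Function.update x q b)
  | toffoli c t _ _, ψ => fun x => ψ (toffoliFun c t x)

theorem toffoliFun_of_ne (C : Finset Q) (t : Q) (x : Q → Bool) {q : Q} (h : q ≠ t) :
    toffoliFun C t x q = x q := by
  simp [toffoliFun, h]

theorem toffoliFun_self (C : Finset Q) (t : Q) (x : Q → Bool) :
    toffoliFun C t x t = xor (x t) (decide (∀ c ∈ C, x c = true)) := by
  simp [toffoliFun]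

theorem toffoliFun_congr {C : Finset Q} {t : Q} (ht : t ∉ C) (x : Q → Bool) :
    (∀ c ∈ C, toffoliFun C t x c = true) ↔ ∀ c ∈ C, x c = true := by
  refine forall₂_congr fun c hc => ?_
  rw [toffoliFun_of_ne]
  rintro rfl
  exact ht hc

theorem toffoliFun_involutive {C : Finset Q} {t : Q} (ht : t ∉ C) :
    Function.Involutive (toffoliFun C t) := by
  intro x
  funext q
  by_cases h : q = t
  · subst h
    rw [toffoliFun_self, toffoliFun_self]
    simp only [toffoliFun_congr ht]
    simp
  · rw [toffoliFun_of_ne _ _ _ h, toffoliFun_of_ne _ _ _ h]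

theorem matrix_mulVec [Fintype Q] (g : QACGate Q) (ψ : QState Q) : g.matrix *ᵥ ψ = g.app ψ := by
  funext x
  cases g with
  | single q u =>
    simp only [matrix, Matrix.mulVec, dotProduct, Matrix.of_apply, app, ite_mul, zero_mul]
    rw [← Finset.sum_filter]
    symm
    refine Finset.sum_bij (fun b _ => Function.update x q b) ?_ ?_ ?_ ?_
    · intro b _
      simp only [Finset.mem_filter, Finset.mem_univ, true_and]
      intro r hr
      simp [hr]
    · intro b _ b' _ h
      simpa using congrFun h q
    · intro y hy
      refine ⟨y q, Finset.mem_univ _, ?_⟩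
      simp only [Finset.mem_filter, Finset.mem_univ, true_and] at hy
      funext r
      by_cases hr : r = q
      · subst hr; simp
      · simp [hr, hy r hr]
    · intro b _
      simp
  | toffoli C t hC ht =>
    have h : ∀ y, x = toffoliFun C t y ↔ toffoliFun C t x = y := fun y =>
      ⟨fun h => by rw [h, toffoliFun_involutive ht], fun h => by rw [← h, toffoliFun_involutive ht]⟩
    simp [matrix, Matrix.mulVec, dotProduct, app, h]

theorem app_single_single {q r : Q} (h : q ≠ r) (u v : Matrix.unitaryGroup Bool ℂ) (ψ : QState Q) :
    (single q u).app ((single r v).app ψ) = (single r v).app ((single q u).app ψ) := by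
  funext x
  simp only [app, Finset.mul_sum]
  rw [Finset.sum_comm]
  refine Finset.sum_congr rfl fun b _ => Finset.sum_congr rfl fun b' _ => ?_
  rw [Function.update_of_ne h.symm, Function.update_of_ne h, Function.update_comm h]
  ring

theorem toffoliFun_update {C : Finset Q} {t q : Q} (hq : q ∉ insert t C) (x : Q → Bool) (b : Bool) :
    toffoliFun C t (Function.update x q b) = Function.update (toffoliFun C t x) q b := by
  simp only [Finset.mem_insert, not_or] at hq
  have h : ∀ c ∈ C, Function.update x q b c = x c := fun c hc => by
    rw [Function.update_of_ne]
    rintro rfl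
    exact hq.2 hc
  funext r
  by_cases hr : r = t
  · subst hr
    rw [toffoliFun_self, Function.update_of_ne (Ne.symm hq.1), Function.update_of_ne (Ne.symm hq.1),
      toffoliFun_self]
    congr 2
    exact propext (forall₂_congr fun c hc => by rw [h c hc])
  · rw [toffoliFun_of_ne _ _ _ hr]
    by_cases hrq : r = q
    · subst hrq; simp
    · simp [hrq, toffoliFun_of_ne _ _ _ hr]

theorem app_single_toffoli {q : Q} {C : Finset Q} {t : Q} (hC : C.Nonempty) (ht : t ∉ C)
    (hq : q ∉ insert t C) (u : Matrix.unitaryGroup Bool ℂ) (ψ : QState Q) :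
    (single q u).app ((toffoli C t hC ht).app ψ) = (toffoli C t hC ht).app ((single q u).app ψ) := by
  funext x
  simp only [app]
  refine Finset.sum_congr rfl fun b _ => ?_
  rw [toffoliFun_update hq, toffoliFun_of_ne]
  rintro rfl
  exact hq (Finset.mem_insert_self _ _)

theorem toffoliFun_comm {C D : Finset Q} {t r : Q} (h : Disjoint (insert t C) (insert r D))
    (x : Q → Bool) :
    toffoliFun C t (toffoliFun D r x) = toffoliFun D r (toffoliFun C t x) := by
  have hr : r ∉ insert t C := fun hr => Finset.disjoint_left.1 h hr (Finset.mem_insert_self _ _)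
  rw [show toffoliFun D r x = Function.update x r _ from rfl, toffoliFun_update hr]
  have ht : t ∉ insert r D := fun ht => Finset.disjoint_left.1 h (Finset.mem_insert_self _ _) ht
  rw [show toffoliFun D r (toffoliFun C t x) = Function.update _ r _ from rfl]
  congr 1
  rw [toffoliFun_of_ne]
  · congr 2
    refine propext (forall₂_congr fun c hc => ?_)
    rw [toffoliFun_of_ne]
    rintro rfl
    exact ht (Finset.mem_insert_of_mem hc)
  · rintro rfl
    exact hr (Finset.mem_insert_self _ _)

theorem app_comm {g h : QACGate Q} (hd : Disjoint g.support h.support) (ψ : QState Q) :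
    g.app (h.app ψ) = h.app (g.app ψ) := by
  cases g with
  | single q u =>
    cases h with
    | single r v => exact app_single_single (by simpa [support] using hd) u v ψ
    | toffoli C t hC ht =>
      exact app_single_toffoli hC ht (by simpa only [support, Finset.disjoint_singleton_left] using hd)
        u ψ
  | toffoli C t hC ht =>
    cases h with
    | single r v =>
      exact (app_single_toffoli hC ht
        (by simpa only [support, Finset.disjoint_singleton_right] using hd) v ψ).symm
    | toffoli D r hD hr =>
      funext x
      simp only [app]
      rw [toffoliFun_comm hd]

theorem matrix_commute [Fintype Q] {g h : QACGate Q} (hd : Disjoint g.support h.support) :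
    Commute g.matrix h.matrix := by
  refine Matrix.ext_of_mulVec_single fun x => ?_
  rw [← Matrix.mulVec_mulVec, ← Matrix.mulVec_mulVec, matrix_mulVec, matrix_mulVec, matrix_mulVec,
    matrix_mulVec, app_comm hd]

/-- The inverse gate. -/
def adj : QACGate Q → QACGate Q
  | single q u => single q (star u)
  | toffoli c t hc ht => toffoli c t hc ht

theorem support_adj (g : QACGate Q) : g.adj.support = g.support := by
  cases g <;> rfl

theorem matrix_adj [Fintype Q] (g : QACGate Q) : g.adj.matrix = g.matrixᴴ := by
  ext x y
  cases g with
  | single q u =>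
    simp only [adj, matrix, Matrix.of_apply, Matrix.conjTranspose_apply]
    simp only [eq_comm (a := x _)]
    split_ifs
    · rw [Unitary.coe_star, Matrix.star_apply]
    · simp
  | toffoli C t hC ht =>
    have h : x = toffoliFun C t y ↔ y = toffoliFun C t x :=
      ⟨fun h => by rw [h, toffoliFun_involutive ht], fun h => by rw [h, toffoliFun_involutive ht]⟩
    simp only [adj, matrix, Matrix.of_apply, Matrix.conjTranspose_apply, h]
    split_ifs <;> simp

theorem app_adj_app (g : QACGate Q) (ψ : QState Q) : g.adj.app (g.app ψ) = ψ := by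
  funext x
  cases g with
  | single q u =>
    simp only [adj, app, Finset.mul_sum, Function.update_self, Function.update_idem]
    rw [Finset.sum_comm]
    have h : ∀ a b, ∑ c, (star u : Matrix Bool Bool ℂ) a c * (u : Matrix Bool Bool ℂ) c b =
        if a = b then 1 else 0 := fun a b => by
      rw [← Matrix.mul_apply, ← Matrix.one_apply]
      rw [Matrix.UnitaryGroup.star_mul_self u]
    simp only [Unitary.coe_star, ← mul_assoc, ← Finset.sum_mul]
    simp only [h, ite_mul, one_mul, zero_mul, Finset.sum_ite_eq,
      Finset.mem_univ, if_true, Function.update_eq_self]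
  | toffoli C t hC ht =>
    simp only [adj, app, toffoliFun_involutive ht x]

theorem conjTranspose_mul_matrix [Fintype Q] (g : QACGate Q) : g.matrixᴴ * g.matrix = 1 := by
  refine Matrix.ext_of_mulVec_single fun x => ?_
  rw [← Matrix.mulVec_mulVec, matrix_mulVec, ← matrix_adj, matrix_mulVec, app_adj_app,
    Matrix.one_mulVec]

end QACGate

/-! ### Operators acting on part of a register. -/

/-- The operator `T` on the register `P`, acting on the qubits of `Q` selected by `e`. -/
noncomputable def liftOp {P Q : Type*} (e : P ↪ Q) (T : QState P → QState P) : QState Q → QState Q :=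
  fun ψ x => T (fun y => ψ (Function.extend e y x)) (x ∘ e)

section liftOp

variable {P Q : Type*} (e : P ↪ Q)

theorem extend_comp_self (y : P → Bool) (x : Q → Bool) : Function.extend e y x ∘ e = y :=
  funext fun p => e.injective.extend_apply y x p

theorem extend_self_comp (x : Q → Bool) : Function.extend e (x ∘ e) x = x := by
  funext q
  by_cases h : ∃ p, e p = q
  · obtain ⟨p, rfl⟩ := h
    exact e.injective.extend_apply _ _ _
  · exact Function.extend_apply' _ _ _ h

theorem extend_extend (y z : P → Bool) (x : Q → Bool) :
    Function.extend e z (Function.extend e y x) = Function.extend e z x := by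
  funext q
  by_cases h : ∃ p, e p = q
  · obtain ⟨p, rfl⟩ := h
    rw [e.injective.extend_apply, e.injective.extend_apply]
  · rw [Function.extend_apply' _ _ _ h, Function.extend_apply' _ _ _ h,
      Function.extend_apply' _ _ _ h]

theorem liftOp_id : liftOp e (id : QState P → QState P) = id := by
  funext ψ x
  simp [liftOp, extend_self_comp]

theorem liftOp_comp (T T' : QState P → QState P) :
    liftOp e (T ∘ T') = liftOp e T ∘ liftOp e T' := by
  funext ψ x
  simp only [liftOp, Function.comp_apply, extend_comp_self, extend_extend]

theorem extend_update [DecidableEq P] [DecidableEq Q] (x : Q → Bool) (p : P) (b : Bool) :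
    Function.extend e (Function.update (x ∘ e) p b) x = Function.update x (e p) b := by
  funext q
  by_cases h : ∃ p, e p = q
  · obtain ⟨r, rfl⟩ := h
    rw [e.injective.extend_apply]
    simp [Function.update_apply]
  · rw [Function.extend_apply' _ _ _ h, Function.update_of_ne]
    rintro rfl
    exact h ⟨p, rfl⟩

end liftOp

namespace QACGate

variable {P Q : Type*} [DecidableEq P] [DecidableEq Q]

/-- The gate on the qubits selected by an embedding. -/
def map (e : P ↪ Q) : QACGate P → QACGate Q
  | single q u => single (e q) u
  | toffoli c t hc ht => toffoli (c.map e) (e t) (hc.map) (by simpa using ht)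

theorem support_map (e : P ↪ Q) (g : QACGate P) : (g.map e).support = g.support.map e := by
  cases g <;> simp [map, support, Finset.map_insert]

theorem app_map (e : P ↪ Q) (g : QACGate P) : (g.map e).app = liftOp e g.app := by
  funext ψ x
  cases g with
  | single q u => simp [map, app, liftOp, extend_update]
  | toffoli C t hC ht =>
    simp only [map, app, liftOp, toffoliFun]
    rw [extend_update]
    simp

end QACGate

/-! ### Products of gates and layers. -/

section layers

variable {Q : Type*} [DecidableEq Q] [Fintype Q]

/-- The product of the gates of a list. -/
def gatesMatrix (L : List (QACGate Q)) : Matrix (Q → Bool) (Q → Bool) ℂ :=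
  (L.map QACGate.matrix).prod

/-- The product of a list of layers, the layer applied last coming first. -/
def layersMatrix (Ls : List (List (QACGate Q))) : Matrix (Q → Bool) (Q → Bool) ℂ :=
  (Ls.map gatesMatrix).prod

theorem gatesMatrix_append (L L' : List (QACGate Q)) :
    gatesMatrix (L ++ L') = gatesMatrix L * gatesMatrix L' := by
  simp [gatesMatrix]

theorem layersMatrix_append (Ls Ls' : List (List (QACGate Q))) :
    layersMatrix (Ls ++ Ls') = layersMatrix Ls * layersMatrix Ls' := by
  simp [layersMatrix]

theorem layersMatrix_cons (L : List (QACGate Q)) (Ls : List (List (QACGate Q))) :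
    layersMatrix (L :: Ls) = gatesMatrix L * layersMatrix Ls := by
  simp [layersMatrix]

theorem gatesMatrix_adj (L : List (QACGate Q)) :
    gatesMatrix (L.reverse.map QACGate.adj) = (gatesMatrix L)ᴴ := by
  induction L with
  | nil => simp [gatesMatrix]
  | cons g L ih =>
    rw [List.reverse_cons, List.map_append, gatesMatrix_append, ih]
    simp [gatesMatrix, QACGate.matrix_adj]

theorem layersMatrix_adj (Ls : List (List (QACGate Q))) :
    layersMatrix (Ls.reverse.map fun L => L.reverse.map QACGate.adj) = (layersMatrix Ls)ᴴ := by
  induction Ls with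
  | nil => simp [layersMatrix]
  | cons L Ls ih =>
    rw [List.reverse_cons, List.map_append, layersMatrix_append, ih, layersMatrix_cons,
      Matrix.conjTranspose_mul]
    simp only [List.map_cons, List.map_nil, layersMatrix_cons, gatesMatrix_adj]
    simp [layersMatrix]

theorem gatesMatrix_unitary (L : List (QACGate Q)) : (gatesMatrix L)ᴴ * gatesMatrix L = 1 := by
  induction L with
  | nil => simp [gatesMatrix]
  | cons g L ih =>
    have h : gatesMatrix (g :: L) = g.matrix * gatesMatrix L := by simp [gatesMatrix]
    rw [h, Matrix.conjTranspose_mul, Matrix.mul_assoc, ← Matrix.mul_assoc _ g.matrix,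
      QACGate.conjTranspose_mul_matrix, Matrix.one_mul, ih]

theorem layersMatrix_unitary (Ls : List (List (QACGate Q))) :
    (layersMatrix Ls)ᴴ * layersMatrix Ls = 1 := by
  induction Ls with
  | nil => simp [layersMatrix]
  | cons L Ls ih =>
    rw [layersMatrix_cons, Matrix.conjTranspose_mul, Matrix.mul_assoc,
      ← Matrix.mul_assoc _ (gatesMatrix L), gatesMatrix_unitary, Matrix.one_mul, ih]

theorem gatesMatrix_commute {L L' : List (QACGate Q)}
    (h : ∀ g ∈ L, ∀ g' ∈ L', Disjoint g.support g'.support) :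
    Commute (gatesMatrix L) (gatesMatrix L') := by
  refine Commute.list_prod_left _ _ fun M hM => Commute.list_prod_right _ _ fun M' hM' => ?_
  obtain ⟨g, hg, rfl⟩ := List.mem_map.1 hM
  obtain ⟨g', hg', rfl⟩ := List.mem_map.1 hM'
  exact QACGate.matrix_commute (h g hg g' hg')

theorem layersMatrix_commute {L : List (QACGate Q)} {Ls : List (List (QACGate Q))}
    (h : ∀ g ∈ L, ∀ L' ∈ Ls, ∀ g' ∈ L', Disjoint g.support g'.support) :
    Commute (gatesMatrix L) (layersMatrix Ls) := by
  refine Commute.list_prod_right _ _ fun M hM => ?_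
  obtain ⟨L', hL', rfl⟩ := List.mem_map.1 hM
  exact gatesMatrix_commute fun g hg => h g hg L' hL'

/-- Gates on disjoint sets commute, so the first layer of one circuit can be moved past all
remaining layers of the other. This lets the two circuits run side by side without adding their
depths. -/
theorem layersMatrix_zipWith {S S' : Finset Q} (hS : Disjoint S S') :
    ∀ {Ls Ls' : List (List (QACGate Q))}, Ls.length = Ls'.length →
      (∀ L ∈ Ls, ∀ g ∈ L, g.support ⊆ S) → (∀ L ∈ Ls', ∀ g ∈ L, g.support ⊆ S') →
      layersMatrix (List.zipWith (· ++ ·) Ls Ls') = layersMatrix Ls * layersMatrix Ls'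
  | [], [], _, _, _ => by simp [layersMatrix]
  | L :: Ls, L' :: Ls', hl, h, h' => by
    have hc : Commute (gatesMatrix L') (layersMatrix Ls) := layersMatrix_commute
      fun g hg L₁ hL₁ g₁ hg₁ =>
        (hS.mono (h L₁ (List.mem_cons_of_mem _ hL₁) g₁ hg₁) (h' L' List.mem_cons_self g hg)).symm
    rw [List.zipWith_cons_cons, layersMatrix_cons, layersMatrix_cons, layersMatrix_cons,
      layersMatrix_zipWith hS (by simpa using hl) (fun L hL => h L (List.mem_cons_of_mem _ hL))
        (fun L hL => h' L (List.mem_cons_of_mem _ hL)), gatesMatrix_append]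
    rw [Matrix.mul_assoc, Matrix.mul_assoc, ← Matrix.mul_assoc (gatesMatrix L'), hc.eq]
    simp only [Matrix.mul_assoc]

end layers

/-! ### Calculus of implementable operators: composition, parallel use, inverses. -/

/-- `T` is the operator of a circuit of depth `d` with at most `s` gates, all of which operate on
qubits in `S`. -/
def ImplOn {Q : Type*} [DecidableEq Q] [Fintype Q] (S : Finset Q) (d s : ℕ)
    (T : QState Q → QState Q) : Prop :=
  ∃ Ls : List (List (QACGate Q)), Ls.length = d ∧ (Ls.map List.length).sum ≤ s ∧
    (∀ L ∈ Ls, L.Pairwise fun g h => Disjoint g.support h.support) ∧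
    (∀ L ∈ Ls, ∀ g ∈ L, g.support ⊆ S) ∧ T = fun ψ => layersMatrix Ls *ᵥ ψ

/-- `T` is the operator of a circuit of depth `d` with at most `s` gates. -/
def Impl {Q : Type*} [DecidableEq Q] [Fintype Q] (d s : ℕ) (T : QState Q → QState Q) : Prop :=
  ImplOn Finset.univ d s T

/-- The operators `T i` applied along the embeddings `e i`, for the indices `i` of a list. -/
noncomputable def parOp {ι P Q : Type*} (l : List ι) (e : ι → P ↪ Q)
    (T : ι → QState P → QState P) : QState Q → QState Q :=
  l.foldr (fun i F => liftOp (e i) (T i) ∘ F) id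

section ImplOn

variable {P Q : Type*} [DecidableEq P] [Fintype P] [DecidableEq Q] [Fintype Q] {S S' : Finset Q}
  {d d' s s' : ℕ} {T T' : QState Q → QState Q}

theorem ImplOn.comp (h : ImplOn S d s T) (h' : ImplOn S d' s' T') :
    ImplOn S (d + d') (s + s') (T ∘ T') := by
  obtain ⟨Ls, rfl, hs, hp, hS, rfl⟩ := h
  obtain ⟨Ls', rfl, hs', hp', hS', rfl⟩ := h'
  refine ⟨Ls ++ Ls', by simp, by simpa using add_le_add hs hs', ?_, ?_, ?_⟩
  · intro L hL
    exact (List.mem_append.1 hL).elim (hp L) (hp' L)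
  · intro L hL
    exact (List.mem_append.1 hL).elim (hS L) (hS' L)
  · funext ψ
    simp [layersMatrix_append]

theorem ImplOn.idle (S : Finset Q) (d : ℕ) : ImplOn S d 0 (id : QState Q → QState Q) :=
  ⟨List.replicate d [], by simp, by simp, fun L hL => by simp [List.eq_of_mem_replicate hL],
    fun L hL => by simp [List.eq_of_mem_replicate hL],
    by funext ψ; simp [layersMatrix, gatesMatrix]⟩

/-- The depth in `ImplOn` is exact, so a larger one is reached by padding with empty layers. -/
theorem ImplOn.mono (h : ImplOn S d s T) (hS : S ⊆ S') (hd : d ≤ d') (hs : s ≤ s') :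
    ImplOn S' d' s' T := by
  have h' := h.comp (ImplOn.idle S (d' - d))
  rw [Nat.add_sub_cancel' hd] at h'
  obtain ⟨Ls, hl, hs', hp, hS', hT⟩ := h'
  exact ⟨Ls, hl, by omega, hp, fun L hL g hg => (hS' L hL g hg).trans hS, hT⟩

theorem ImplOn.par (h : ImplOn S d s T) (h' : ImplOn S' d s' T') (hd : Disjoint S S') :
    ImplOn (S ∪ S') d (s + s') (T ∘ T') := by
  obtain ⟨Ls, rfl, hs, hp, hS, rfl⟩ := h
  obtain ⟨Ls', hl, hs', hp', hS', rfl⟩ := h'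
  refine ⟨List.zipWith (· ++ ·) Ls Ls', by simp [hl], ?_, ?_, ?_, ?_⟩
  · refine le_trans (le_of_eq ?_) (add_le_add hs hs')
    clear hs hs' hp hp' hS hS'
    induction Ls generalizing Ls' with
    | nil => simp [List.length_eq_zero_iff.1 hl]
    | cons L Ls ih =>
      cases Ls' with
      | nil => simp at hl
      | cons L' Ls' =>
        have := ih Ls' (by simpa using hl)
        simp only [List.zipWith_cons_cons, List.map_cons, List.sum_cons, List.length_append, this]
        ring
  · intro L hL
    obtain ⟨i, hi, rfl⟩ := List.getElem_of_mem hL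
    rw [List.getElem_zipWith, List.pairwise_append]
    exact ⟨hp _ (List.getElem_mem _), hp' _ (List.getElem_mem _), fun g hg g' hg' =>
      hd.mono (hS _ (List.getElem_mem _) g hg) (hS' _ (List.getElem_mem _) g' hg')⟩
  · intro L hL g hg
    obtain ⟨i, hi, rfl⟩ := List.getElem_of_mem hL
    rw [List.getElem_zipWith] at hg
    exact (List.mem_append.1 hg).elim
      (fun hg => (hS _ (List.getElem_mem _) g hg).trans Finset.subset_union_left)
      (fun hg => (hS' _ (List.getElem_mem _) g hg).trans Finset.subset_union_right)
  · funext ψ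
    rw [layersMatrix_zipWith hd hl.symm hS hS', ← Matrix.mulVec_mulVec]
    rfl

theorem ImplOn.gate (g : QACGate Q) (hg : g.support ⊆ S) : ImplOn S 1 1 g.app :=
  ⟨[[g]], by simp, by simp, by simp, by simpa using hg,
    by funext ψ; simp [layersMatrix, gatesMatrix, QACGate.matrix_mulVec]⟩

theorem liftOp_gatesMatrix (e : P ↪ Q) (L : List (QACGate P)) :
    (fun ψ => gatesMatrix (L.map (QACGate.map e)) *ᵥ ψ) =
      liftOp e fun ψ => gatesMatrix L *ᵥ ψ := by
  induction L with
  | nil =>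
    have : liftOp e (fun ψ : QState P => ψ) = id := liftOp_id e
    simp only [List.map_nil, gatesMatrix, List.prod_nil, Matrix.one_mulVec, this]
    rfl
  | cons g L ih =>
    have h : (fun ψ => gatesMatrix (g :: L) *ᵥ ψ) = g.app ∘ fun ψ => gatesMatrix L *ᵥ ψ := by
      funext ψ
      simp [gatesMatrix, ← QACGate.matrix_mulVec]
    rw [h, liftOp_comp, ← ih, ← QACGate.app_map]
    funext ψ
    simp [gatesMatrix, ← QACGate.matrix_mulVec]

theorem liftOp_layersMatrix (e : P ↪ Q) (Ls : List (List (QACGate P))) :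
    (fun ψ => layersMatrix (Ls.map fun L => L.map (QACGate.map e)) *ᵥ ψ) =
      liftOp e fun ψ => layersMatrix Ls *ᵥ ψ := by
  induction Ls with
  | nil =>
    have : liftOp e (fun ψ : QState P => ψ) = id := liftOp_id e
    simp only [List.map_nil, layersMatrix, List.prod_nil, Matrix.one_mulVec, this]
    rfl
  | cons L Ls ih =>
    have h : (fun ψ => layersMatrix (L :: Ls) *ᵥ ψ) =
        (fun ψ => gatesMatrix L *ᵥ ψ) ∘ fun ψ => layersMatrix Ls *ᵥ ψ := by
      funext ψ
      simp [layersMatrix_cons]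
    rw [h, liftOp_comp, ← ih, ← liftOp_gatesMatrix]
    funext ψ
    simp [layersMatrix_cons]

theorem ImplOn.lift {T : QState P → QState P} (h : Impl d s T) (e : P ↪ Q) :
    ImplOn (Finset.univ.map e) d s (liftOp e T) := by
  obtain ⟨Ls, rfl, hs, hp, -, rfl⟩ := h
  refine ⟨Ls.map fun L => L.map (QACGate.map e), by simp, ?_, ?_, ?_,
    (liftOp_layersMatrix e Ls).symm⟩
  · simpa [Function.comp_def] using hs
  · intro L hL
    obtain ⟨L', hL', rfl⟩ := List.mem_map.1 hL
    rw [List.pairwise_map]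
    refine (hp L' hL').imp fun h => ?_
    rwa [QACGate.support_map, QACGate.support_map, Finset.disjoint_map]
  · intro L hL g hg
    obtain ⟨L', -, rfl⟩ := List.mem_map.1 hL
    obtain ⟨g', -, rfl⟩ := List.mem_map.1 hg
    rw [QACGate.support_map]
    exact Finset.map_subset_map.2 (Finset.subset_univ _)

theorem ImplOn.parallel {ι : Type*} [DecidableEq ι] {l : List ι} (hl : l.Nodup) {e : ι → P ↪ Q}
    (he : Pairwise fun i j => ∀ p q, e i p ≠ e j q) {T : ι → QState P → QState P}
    (hT : ∀ i, Impl d s (T i)) :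
    ImplOn (l.toFinset.biUnion fun i => Finset.univ.map (e i)) d (l.length * s) (parOp l e T) := by
  induction l with
  | nil => simpa [parOp] using ImplOn.idle ∅ d
  | cons i l ih =>
    rw [List.nodup_cons] at hl
    have h := (ImplOn.lift (hT i) (e i)).par (ih hl.2) ?_
    · rw [List.toFinset_cons, Finset.biUnion_insert, List.length_cons, add_mul, one_mul, add_comm]
      exact h
    · rw [Finset.disjoint_biUnion_right]
      intro j hj
      have hij : i ≠ j := by
        rintro rfl
        exact hl.1 (List.mem_toFinset.1 hj)
      rw [Finset.disjoint_left]
      intro q hq hq'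
      obtain ⟨p, -, rfl⟩ := Finset.mem_map.1 hq
      obtain ⟨p', -, hp'⟩ := Finset.mem_map.1 hq'
      exact he hij p p' hp'.symm

end ImplOn

section Impl

variable {P Q : Type*} [DecidableEq P] [Fintype P] [DecidableEq Q] [Fintype Q]
  {d d' s s' : ℕ} {T T' : QState Q → QState Q}

theorem Impl.comp (h : Impl d s T) (h' : Impl d' s' T') : Impl (d + d') (s + s') (T ∘ T') :=
  ImplOn.comp h h'

theorem Impl.mono (h : Impl d s T) (hd : d ≤ d') (hs : s ≤ s') : Impl d' s' T :=
  ImplOn.mono h le_rfl hd hs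

theorem Impl.gate (g : QACGate Q) : Impl 1 1 g.app :=
  ImplOn.gate g (Finset.subset_univ _)

theorem Impl.lift {T : QState P → QState P} (h : Impl d s T) (e : P ↪ Q) :
    Impl d s (liftOp e T) :=
  (ImplOn.lift h e).mono (Finset.subset_univ _) le_rfl le_rfl

theorem Impl.parallel {ι : Type*} [Fintype ι] [DecidableEq ι] {e : ι → P ↪ Q}
    (he : Pairwise fun i j => ∀ p q, e i p ≠ e j q) {T : ι → QState P → QState P}
    (hT : ∀ i, Impl d s (T i)) :
    Impl d (Fintype.card ι * s) (parOp Finset.univ.toList e T) := by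
  have h := ImplOn.parallel (Finset.nodup_toList Finset.univ) he hT
  rw [Finset.length_toList] at h
  exact h.mono (Finset.subset_univ _) le_rfl le_rfl

theorem Impl.map_smul (h : Impl d s T) (c : ℂ) (ψ : QState Q) : T (c • ψ) = c • T ψ := by
  obtain ⟨Ls, -, -, -, -, rfl⟩ := h
  exact Matrix.mulVec_smul _ _ _

theorem Impl.map_add (h : Impl d s T) (ψ φ : QState Q) : T (ψ + φ) = T ψ + T φ := by
  obtain ⟨Ls, -, -, -, -, rfl⟩ := h
  exact Matrix.mulVec_add _ _ _

theorem Impl.map_sub (h : Impl d s T) (ψ φ : QState Q) : T (ψ - φ) = T ψ - T φ := by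
  obtain ⟨Ls, -, -, -, -, rfl⟩ := h
  exact Matrix.mulVec_sub _ _ _

theorem Impl.map_sum (h : Impl d s T) {ι : Type*} (t : Finset ι) (ψ : ι → QState Q) :
    T (∑ i ∈ t, ψ i) = ∑ i ∈ t, T (ψ i) := by
  obtain ⟨Ls, -, -, -, -, rfl⟩ := h
  exact Matrix.mulVec_sum _ _ _

/-- The adjoint of a circuit operator is implemented by the inverse circuit. -/
theorem Impl.exists_adjoint (h : Impl d s T) :
    ∃ T' : QState Q → QState Q, Impl d s T' ∧ (∀ ψ, T' (T ψ) = ψ) ∧ (∀ ψ, T (T' ψ) = ψ) ∧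
      ∀ φ ψ, star φ ⬝ᵥ T' ψ = star (T φ) ⬝ᵥ ψ := by
  obtain ⟨Ls, rfl, hs, hp, -, rfl⟩ := h
  have hu := layersMatrix_unitary Ls
  refine ⟨fun ψ => (layersMatrix Ls)ᴴ *ᵥ ψ,
    ⟨Ls.reverse.map fun L => L.reverse.map QACGate.adj, by simp, ?_, ?_, ?_, ?_⟩, ?_, ?_, ?_⟩
  · simpa [Function.comp_def, List.sum_reverse] using hs
  · intro L hL
    obtain ⟨L', hL', rfl⟩ := List.mem_map.1 hL
    rw [List.pairwise_map, List.pairwise_reverse]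
    refine (hp L' (List.mem_reverse.1 hL')).imp fun h => ?_
    rw [QACGate.support_adj, QACGate.support_adj]
    exact h.symm
  · exact fun _ _ _ _ => Finset.subset_univ _
  · rw [layersMatrix_adj]
  · intro ψ
    simp [hu]
  · intro ψ
    simp [mul_eq_one_comm.1 hu]
  · intro φ ψ
    rw [Matrix.dotProduct_mulVec, Matrix.star_mulVec]

theorem Impl.dotProduct (h : Impl d s T) (φ ψ : QState Q) :
    star (T φ) ⬝ᵥ T ψ = star φ ⬝ᵥ ψ := by
  obtain ⟨T', -, h₁, -, h₂⟩ := h.exists_adjoint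
  rw [← h₂, h₁]

end Impl

/-! ### Parallel operators on product states and on basis permutations. -/

section parOp

variable {ι P Q : Type*}

/-- The factor `ρ` carries the qubits outside all blocks. With the other blocks held fixed, the
state seen by block `j` is a scalar multiple of `φ j`, which is why homogeneity of `T` is enough. -/
theorem parOp_prod [Fintype ι] [DecidableEq ι] {e : ι → P ↪ Q}
    (he : Pairwise fun i j => ∀ p q, e i p ≠ e j q) {T : ι → QState P → QState P}
    (hT : ∀ i (c : ℂ) ψ, T i (c • ψ) = c • T i ψ) (φ : ι → QState P) {ρ : QState Q}
    (hρ : ∀ i y x, ρ (Function.extend (e i) y x) = ρ x) {l : List ι} (hl : l.Nodup) :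
    parOp l e T (fun x => (∏ i, φ i (x ∘ e i)) * ρ x) =
      fun x => (∏ i, (if i ∈ l then T i (φ i) else φ i) (x ∘ e i)) * ρ x := by
  induction l with
  | nil => simp [parOp]
  | cons j l ih =>
    rw [List.nodup_cons] at hl
    have ih' := ih hl.2
    simp only [parOp, List.foldr_cons, Function.comp_apply] at ih' ⊢
    rw [ih']
    funext x
    have hne : ∀ y, ∀ i ≠ j, Function.extend (e j) y x ∘ e i = x ∘ e i := fun y i hi => by
      funext p
      exact Function.extend_apply' _ _ _ fun ⟨p', hp'⟩ => he hi p p' hp'.symm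
    have hprod : ∀ F : ι → QState P, ∀ z : Q → Bool, ∏ i, F i (z ∘ e i) =
        F j (z ∘ e j) * ∏ i ∈ Finset.univ.erase j, F i (z ∘ e i) := fun F z =>
      (Finset.mul_prod_erase _ _ (Finset.mem_univ j)).symm
    have h : (fun y => (∏ i, (if i ∈ l then T i (φ i) else φ i) (Function.extend (e j) y x ∘ e i)) *
        ρ (Function.extend (e j) y x)) = ((∏ i ∈ Finset.univ.erase j,
          (if i ∈ l then T i (φ i) else φ i) (x ∘ e i)) * ρ x) • φ j := by
      funext y
      rw [hprod, hρ, if_neg hl.1, extend_comp_self]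
      rw [Finset.prod_congr rfl fun i hi => by rw [hne y i (Finset.ne_of_mem_erase hi)]]
      simp only [Pi.smul_apply, smul_eq_mul]
      ring
    rw [liftOp, h, hT, hprod, if_pos List.mem_cons_self]
    have hcons : ∀ i ∈ Finset.univ.erase j, (if i ∈ l then T i (φ i) else φ i) (x ∘ e i) =
        (if i ∈ j :: l then T i (φ i) else φ i) (x ∘ e i) := fun i hi => by
      simp [Finset.ne_of_mem_erase hi]
    rw [Finset.prod_congr rfl hcons]
    simp only [Pi.smul_apply, smul_eq_mul]
    ring

theorem parOp_univ_prod [Fintype ι] [DecidableEq ι] {e : ι → P ↪ Q}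
    (he : Pairwise fun i j => ∀ p q, e i p ≠ e j q) {T : ι → QState P → QState P}
    (hT : ∀ i (c : ℂ) ψ, T i (c • ψ) = c • T i ψ) (φ : ι → QState P) {ρ : QState Q}
    (hρ : ∀ i y x, ρ (Function.extend (e i) y x) = ρ x) :
    parOp Finset.univ.toList e T (fun x => (∏ i, φ i (x ∘ e i)) * ρ x) =
      fun x => (∏ i, T i (φ i) (x ∘ e i)) * ρ x := by
  rw [parOp_prod he hT φ hρ (Finset.nodup_toList _)]
  simp

/-- Reversible classical circuits in parallel are again substitutions on strings; the map `F` is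
known only through its restriction to each block and outside them, which is all that is used later.
-/
theorem exists_parOp_eq_comp {e : ι → P ↪ Q} (he : Pairwise fun i j => ∀ p q, e i p ≠ e j q)
    (f : ι → (P → Bool) → P → Bool) {l : List ι} (hl : l.Nodup) :
    ∃ F : (Q → Bool) → Q → Bool, (parOp l e fun i ψ => ψ ∘ f i) = (fun ψ => ψ ∘ F) ∧
      (∀ x, ∀ i ∈ l, F x ∘ e i = f i (x ∘ e i)) ∧
      ∀ x q, (∀ i ∈ l, ∀ p, e i p ≠ q) → F x q = x q := by
  induction l with
  | nil => exact ⟨id, rfl, by simp, by simp⟩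
  | cons j l ih =>
    rw [List.nodup_cons] at hl
    obtain ⟨F, hF, hF₁, hF₂⟩ := ih hl.2
    let G : (Q → Bool) → Q → Bool := fun x => Function.extend (e j) (f j (x ∘ e j)) x
    refine ⟨F ∘ G, ?_, ?_, ?_⟩
    · funext ψ x
      simp only [parOp, List.foldr_cons, Function.comp_apply] at hF ⊢
      rw [hF]
      rfl
    · intro x i hi
      rcases List.mem_cons.1 hi with rfl | hi
      · funext p
        rw [Function.comp_apply, Function.comp_apply, hF₂]
        · exact (e i).injective.extend_apply _ _ _
        · rintro i' hi' p'
          refine he ?_ _ _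
          rintro rfl
          exact hl.1 hi'
      · rw [Function.comp_apply, hF₁ _ i hi]
        congr 1
        funext p
        refine Function.extend_apply' _ _ _ fun ⟨p', hp'⟩ => he ?_ _ _ hp'
        rintro rfl
        exact hl.1 hi
    · intro x q hq
      rw [Function.comp_apply, hF₂ _ _ fun i hi => hq i (List.mem_cons_of_mem _ hi)]
      exact Function.extend_apply' _ _ _ fun ⟨p', hp'⟩ => hq j List.mem_cons_self p' hp'

theorem exists_parOp_univ_eq_comp [Fintype ι] {e : ι → P ↪ Q}
    (he : Pairwise fun i j => ∀ p q, e i p ≠ e j q) (f : ι → (P → Bool) → P → Bool) :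
    ∃ F : (Q → Bool) → Q → Bool,
      (parOp Finset.univ.toList e fun i ψ => ψ ∘ f i) = (fun ψ => ψ ∘ F) ∧
      (∀ x i, F x ∘ e i = f i (x ∘ e i)) ∧ ∀ x q, (∀ i p, e i p ≠ q) → F x q = x q := by
  obtain ⟨F, h₁, h₂, h₃⟩ := exists_parOp_eq_comp he f (Finset.nodup_toList Finset.univ)
  exact ⟨F, h₁, fun x i => h₂ x i (by simp), fun x q h => h₃ x q fun i _ => h i⟩

theorem involutive_of_comp_eq {e : ι → P ↪ Q} {f : ι → (P → Bool) → P → Bool}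
    (hf : ∀ i, Function.Involutive (f i)) {F : (Q → Bool) → Q → Bool}
    (h : ∀ x i, F x ∘ e i = f i (x ∘ e i)) (h' : ∀ x q, (∀ i p, e i p ≠ q) → F x q = x q) :
    Function.Involutive F := by
  intro x
  funext q
  by_cases hq : ∃ i p, e i p = q
  · obtain ⟨i, p, rfl⟩ := hq
    have h₁ : (F (F x) ∘ e i) p = (x ∘ e i) p := by rw [h, h, hf]
    exact h₁
  · push Not at hq
    rw [h' _ _ hq, h' _ _ hq]

end parOp

/-! ### Elementary circuits and exact amplitude amplification. -/

section basic

variable {Q : Type*} [DecidableEq Q] [Fintype Q]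

/-- The one-qubit reflection with rows `(c, s)` and `(s, -c)`. -/
noncomputable def reflGate (c s : ℝ) (h : c ^ 2 + s ^ 2 = 1) : Matrix.unitaryGroup Bool ℂ :=
  ⟨Matrix.of fun a b => if a then (if b then -(c : ℂ) else s) else (if b then s else c), by
    have h' : (c : ℂ) ^ 2 + (s : ℂ) ^ 2 = 1 := by exact_mod_cast h
    rw [Matrix.mem_unitaryGroup_iff]
    ext a b
    cases a <;> cases b <;>
      simp only [Matrix.mul_apply, Matrix.star_apply, Matrix.of_apply, Fintype.sum_bool, if_true,
        if_false, Bool.false_eq_true, RCLike.star_def, Complex.conj_ofReal, map_neg, ne_eq,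
        reduceCtorEq, not_false_eq_true, Matrix.one_apply_eq, Matrix.one_apply_ne] <;>
      first | ring1 | linear_combination h'⟩

theorem reflGate_apply (c s : ℝ) (h : c ^ 2 + s ^ 2 = 1) (a b : Bool) :
    (reflGate c s h : Matrix Bool Bool ℂ) a b =
      if a then (if b then -(c : ℂ) else s) else (if b then s else c) := rfl

/-- The Pauli gate `X`. -/
noncomputable def xGate : Matrix.unitaryGroup Bool ℂ := reflGate 0 1 (by norm_num)

/-- The Pauli gate `Z`. -/
noncomputable def zGate : Matrix.unitaryGroup Bool ℂ := reflGate 1 0 (by norm_num)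

/-- The Hadamard gate. -/
noncomputable def hGate : Matrix.unitaryGroup Bool ℂ :=
  reflGate (√(1 / 2)) (√(1 / 2)) (by rw [Real.sq_sqrt (by norm_num)]; norm_num)

/-- The reflection that maps `|0⟩` to `√(1 - p) |0⟩ + √p |1⟩`. -/
noncomputable def biasGate (p : ℝ) (h₀ : 0 ≤ p) (h₁ : p ≤ 1) : Matrix.unitaryGroup Bool ℂ :=
  reflGate (√(1 - p)) (√p) (by
    rw [Real.sq_sqrt h₀, Real.sq_sqrt (sub_nonneg.2 h₁)]; ring)

omit [Fintype Q] in
theorem xGate_app (q : Q) (ψ : QState Q) :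
    (QACGate.single q xGate).app ψ = fun x => ψ (Function.update x q (!x q)) := by
  funext x
  cases h : x q <;> simp [QACGate.app, xGate, reflGate_apply, h]

/-- A qubit, as a register. -/
def qubitEmb {Q : Type*} (q : Q) : Unit ↪ Q := ⟨fun _ => q, fun _ _ _ => rfl⟩

theorem qubitEmb_apply {Q : Type*} (q : Q) (p : Unit) : qubitEmb q p = q := rfl

/-- One single-qubit gate on every qubit. -/
noncomputable def singleLayer (u : Q → Matrix.unitaryGroup Bool ℂ) : QState Q → QState Q :=
  parOp Finset.univ.toList qubitEmb
    fun q => (QACGate.single () (u q)).app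

theorem pairwise_qubitEmb {Q : Type*} :
    Pairwise fun i j : Q => ∀ p q, qubitEmb i p ≠ qubitEmb j q :=
  fun _ _ h _ _ => h

theorem impl_singleLayer (u : Q → Matrix.unitaryGroup Bool ℂ) :
    Impl 1 (Fintype.card Q) (singleLayer u) := by
  have h := Impl.parallel (d := 1) (s := 1) pairwise_qubitEmb
    fun q : Q => Impl.gate (QACGate.single () (u q))
  rwa [mul_one] at h

/-- A product state, given by the amplitudes of its qubits. -/
def prodState (f : Q → Bool → ℂ) : QState Q := fun x => ∏ q, f q (x q)

theorem zeroState_eq_prodState :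
    zeroState Q = prodState fun _ b => if b then 0 else 1 := by
  funext x
  simp only [zeroState, ket, prodState, Pi.single_apply]
  split_ifs with h
  · subst h; simp
  · obtain ⟨q, hq⟩ := Function.ne_iff.1 h
    exact (Finset.prod_eq_zero (Finset.mem_univ q) (by simp at hq; simp [hq])).symm

theorem singleLayer_prodState (u : Q → Matrix.unitaryGroup Bool ℂ) (f : Q → Bool → ℂ) :
    singleLayer u (prodState f) =
      prodState fun q a => ∑ b, (u q : Matrix Bool Bool ℂ) a b * f q b := by
  have h := parOp_univ_prod pairwise_qubitEmb
    (T := fun q : Q => (QACGate.single () (u q)).app)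
    (fun q => (Impl.gate (QACGate.single () (u q))).map_smul) (fun q y => f q (y ()))
    (ρ := fun _ => 1) (fun _ _ _ => rfl)
  simp only [mul_one] at h
  refine Eq.trans h ?_
  funext x
  simp [prodState, QACGate.app, qubitEmb_apply]

theorem sum_prodState (f : Q → Bool → ℂ) : ∑ x, prodState f x = ∏ q, ∑ b, f q b := by
  rw [Finset.prod_univ_sum, Fintype.piFinset_univ]
  rfl

theorem prodState_dotProduct (f g : Q → Bool → ℂ) :
    star (prodState f) ⬝ᵥ prodState g = ∏ q, ∑ b, star (f q b) * g q b := by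
  rw [← sum_prodState]
  simp [dotProduct, prodState, Finset.prod_mul_distrib]

/-- Multiplication by `-1` of the amplitudes of the strings selected by `g`. -/
def phaseOp (g : (Q → Bool) → Bool) : QState Q → QState Q :=
  fun ψ x => if g x then -ψ x else ψ x

/-- A layer of `X` gates where `v` is `1` and identity gates elsewhere. -/
theorem impl_mask (v : Q → Bool) :
    Impl 1 (Fintype.card Q) (fun ψ : QState Q => ψ ∘ fun x q => xor (x q) (v q)) := by
  obtain ⟨F, h₁, h₂, -⟩ := exists_parOp_univ_eq_comp (pairwise_qubitEmb (Q := Q))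
    (fun q y _ => xor (y ()) (v q))
  have hF : F = fun x q => xor (x q) (v q) := funext fun x => funext fun q => congrFun (h₂ x q) ()
  rw [← hF, ← h₁]
  have h := impl_singleLayer (fun q => if v q then xGate else 1)
  convert h using 1
  unfold singleLayer
  congr 1
  funext q ψ
  by_cases hq : v q = true
  · simp only [if_pos hq, xGate_app]
    funext y
    refine congrArg ψ (funext fun _ => ?_)
    simp [hq]
  · simp only [if_neg hq]
    funext y
    simp only [QACGate.app, Function.comp_apply]
    rw [Finset.sum_eq_single (y ())]
    · simp only [OneMemClass.coe_one, Matrix.one_apply_eq, one_mul]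
      refine congrArg ψ (funext fun _ => ?_)
      simp [hq]
    · intro b _ hb
      simp [Matrix.one_apply_ne hb.symm]
    · simp

theorem Impl.phaseOp_conj {d s d' s' : ℕ} {F : (Q → Bool) → Q → Bool}
    (hF : Impl d s fun ψ : QState Q => ψ ∘ F) (hi : Function.Involutive F)
    {g : (Q → Bool) → Bool} (hg : Impl d' s' (phaseOp g)) :
    Impl (d + (d' + d)) (s + (s' + s)) (phaseOp (g ∘ F)) := by
  convert hF.comp (hg.comp hF) using 1
  funext ψ x
  simp [phaseOp, hi x]

theorem Impl.comp_perm_conj {d s d' s' : ℕ} {F G : (Q → Bool) → Q → Bool}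
    (hF : Impl d s fun ψ : QState Q => ψ ∘ F) (hG : Impl d' s' fun ψ : QState Q => ψ ∘ G) :
    Impl (d + (d' + d)) (s + (s' + s)) (fun ψ : QState Q => ψ ∘ (F ∘ G ∘ F)) :=
  hF.comp (hG.comp hF)

theorem involutive_mask {Q : Type*} (v : Q → Bool) :
    Function.Involutive fun (x : Q → Bool) q => xor (x q) (v q) := by
  intro x
  funext q
  simp

/-- A multiply controlled `Z` is a Toffoli gate with its target conjugated by Hadamards. For a
singleton no control is left, and the gate is `Z` itself. -/
theorem impl_phaseOp_ones {S : Finset Q} (hS : S.Nonempty) :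
    Impl 3 3 (phaseOp fun x : Q → Bool => decide (∀ q ∈ S, x q = true)) := by
  obtain ⟨t, ht⟩ := hS
  by_cases hC : (S.erase t).Nonempty
  · have htC : t ∉ S.erase t := Finset.notMem_erase t S
    have h := (Impl.gate (QACGate.single t hGate)).comp
      ((Impl.gate (QACGate.toffoli _ t hC htC)).comp (Impl.gate (QACGate.single t hGate)))
    convert h using 1
    funext ψ x
    have hc : ((√(1 / 2) : ℝ) : ℂ) * ((√(1 / 2) : ℝ) : ℂ) = 1 / 2 := by
      rw [← Complex.ofReal_mul, Real.mul_self_sqrt (by norm_num)]; norm_num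
    have hu : ∀ b, QACGate.toffoliFun (S.erase t) t (Function.update x t b) =
        Function.update x t (xor b (decide (∀ q ∈ S.erase t, x q = true))) := fun b => by
      rw [QACGate.toffoliFun, Function.update_idem, Function.update_self]
      congr 3
      refine propext (forall₂_congr fun q hq => ?_)
      rw [Function.update_of_ne (Finset.ne_of_mem_erase hq)]
    have hS : decide (∀ q ∈ S, x q = true) =
        (x t && decide (∀ q ∈ S.erase t, x q = true)) := by
      rw [← Bool.decide_coe (x t), ← Bool.decide_and, decide_eq_decide]
      conv_lhs => rw [← Finset.insert_erase ht]
      exact Finset.forall_mem_insert _ _ _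
    have hx : ∀ b, x t = b → ψ (Function.update x t b) = ψ x := by
      rintro b rfl
      rw [Function.update_eq_self]
    simp only [Function.comp_apply, QACGate.app, hu, Function.update_idem, Function.update_self,
      Fintype.sum_bool, hGate, reflGate_apply, phaseOp, hS]
    generalize ((√(1 / 2) : ℝ) : ℂ) = c at hc
    generalize decide (∀ q ∈ S.erase t, x q = true) = a
    cases a <;> cases hxt : x t <;> rw [← hx _ hxt] <;>
      simp only [Bool.xor_true, Bool.xor_false, Bool.not_true, Bool.not_false, Bool.and_true,
        Bool.and_false, if_true, if_false, Bool.false_eq_true]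
    · linear_combination (-2 * ψ (Function.update x t false)) * hc
    · linear_combination (-2 * ψ (Function.update x t true)) * hc
    · linear_combination (-2 * ψ (Function.update x t false)) * hc
    · linear_combination (2 * ψ (Function.update x t true)) * hc
  · have hS : S = {t} := by
      rw [Finset.not_nonempty_iff_eq_empty, Finset.erase_eq_empty_iff] at hC
      exact hC.resolve_left (Finset.ne_empty_of_mem ht)
    subst hS
    refine Impl.mono (d := 1) (s := 1) ?_ (by norm_num) (by norm_num)
    convert Impl.gate (QACGate.single t zGate) using 1
    funext ψ x
    cases h : x t <;> simp [phaseOp, QACGate.app, zGate, reflGate_apply, h] <;>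
      rw [← h, Function.update_eq_self]

theorem impl_phaseOp_pattern {S : Finset Q} (hS : S.Nonempty) (v : Q → Bool) :
    Impl 5 (2 * Fintype.card Q + 3)
      (phaseOp fun x : Q → Bool => decide (∀ q ∈ S, x q = v q)) := by
  have h := (impl_mask fun q => !v q).phaseOp_conj (involutive_mask _) (impl_phaseOp_ones hS)
  convert h.mono (d' := 5) (s' := 2 * Fintype.card Q + 3) (by norm_num) (by omega) using 2
  funext x
  simp only [Function.comp_apply]
  congr 1
  refine propext (forall₂_congr fun q _ => ?_)
  cases x q <;> cases v q <;> simp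

/-- The bit flip of the distinguished qubit when `g` holds for the other ones. -/
def flipFun {ι : Type*} (g : (ι → Bool) → Bool) (x : Option ι → Bool) : Option ι → Bool
  | none => xor (x none) (g (x ∘ some))
  | some i => x (some i)

theorem flipFun_comp_some {ι : Type*} (g : (ι → Bool) → Bool) (x : Option ι → Bool) :
    flipFun g x ∘ some = x ∘ some := rfl

theorem flipFun_flipFun {ι : Type*} (g g' : (ι → Bool) → Bool) (x : Option ι → Bool) :
    flipFun g (flipFun g' x) = flipFun (fun y => xor (g y) (g' y)) x := by
  funext q
  cases q with
  | none => simp [flipFun, flipFun_comp_some, Bool.xor_comm (g _)]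
  | some i => rfl

theorem flipFun_involutive {ι : Type*} (g : (ι → Bool) → Bool) :
    Function.Involutive (flipFun g) := by
  intro x
  rw [flipFun_flipFun]
  funext q
  cases q <;> simp [flipFun]

/-- The `NOR` of the qubits in `S`. -/
def norFun {Q : Type*} [DecidableEq Q] (S : Finset Q) (y : Q → Bool) : Bool :=
  decide (∀ q ∈ S, y q = false)

/-- De Morgan: a Toffoli gate between two layers of `X` on all input qubits. The NOR of no bits is
true, so for empty `S` the gate is a plain `X`. -/
theorem impl_flipFun_nor (S : Finset Q) :
    Impl 3 (2 * Fintype.card Q + 3) (fun ψ : QState (Option Q) =>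
      ψ ∘ flipFun (norFun S)) := by
  have hcard : Fintype.card (Option Q) = Fintype.card Q + 1 := Fintype.card_option
  by_cases hS : S.Nonempty
  · have hS' : (S.map Function.Embedding.some).Nonempty := hS.map
    have h := (impl_mask (Q := Option Q) fun q => q.isSome).comp_perm_conj
      (G := QACGate.toffoliFun (S.map Function.Embedding.some) none)
      (Impl.gate (QACGate.toffoli _ none hS' (by simp)))
    convert h.mono (d' := 3) (s' := 2 * Fintype.card Q + 3) (by norm_num) (by omega) using 3
    funext x q
    cases q with
    | none =>
      simp [flipFun, norFun, QACGate.toffoliFun]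
    | some q =>
      simp [flipFun, QACGate.toffoliFun]
  · rw [Finset.not_nonempty_iff_eq_empty] at hS
    subst hS
    refine Impl.mono (d := 1) (s := 1) ?_ (by norm_num) (by omega)
    convert Impl.gate (QACGate.single (none : Option Q) xGate) using 1
    funext ψ
    rw [xGate_app]
    funext x
    refine congrArg ψ (funext fun q => ?_)
    cases q <;> simp [flipFun, norFun]

/-- Amplitude amplification: if the good part `χ` of the state `A|0⟩` has squared norm `1/4`, then
the normalized good part can be prepared exactly. -/
theorem exists_impl_amplify [Nonempty Q] {dA sA dO sO : ℕ} {A O : QState Q → QState Q}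
    (hA : Impl dA sA A) (hO : Impl dO sO O) {χ : QState Q}
    (hχ : O (A (zeroState Q)) = A (zeroState Q) - (2 : ℂ) • χ)
    (hq : star (A (zeroState Q)) ⬝ᵥ χ = 1 / 4) :
    ∃ T : QState Q → QState Q, Impl (3 * dA + dO + 6) (3 * sA + sO + 2 * Fintype.card Q + 4) T ∧
      T (zeroState Q) = (2 : ℂ) • χ := by
  obtain ⟨A', hA', -, hAA', hadj⟩ := hA.exists_adjoint
  have hR := impl_phaseOp_pattern (Q := Q) Finset.univ_nonempty fun _ => false
  -- The Grover round produces `-2χ`; the scalar `-1` is itself a single-qubit unitary, so even the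
  -- global sign is exact.
  have hN : Impl 1 1 (fun ψ : QState Q => -ψ) := by
    convert Impl.gate (QACGate.single (Classical.arbitrary Q) (-1)) using 1
    funext ψ x
    have hm : ((-1 : Matrix.unitaryGroup Bool ℂ) : Matrix Bool Bool ℂ) = -1 := rfl
    simp only [QACGate.app, hm, Matrix.neg_apply]
    rw [Finset.sum_eq_single (x (Classical.arbitrary Q))]
    · simp
    · intro b _ hb
      simp [Matrix.one_apply_ne hb.symm]
    · simp
  refine ⟨_, (hN.comp (hA.comp (hR.comp (hA'.comp (hO.comp hA))))).mono (by omega) (by omega), ?_⟩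
  have hR' : ∀ w : QState Q, phaseOp (fun x : Q → Bool => decide (∀ q ∈ Finset.univ, x q = false)) w
      = w - (2 * (star (zeroState Q) ⬝ᵥ w)) • zeroState Q := by
    intro w
    funext x
    have h₀ : star (zeroState Q) ⬝ᵥ w = w fun _ => false := by
      simp [zeroState, ket, dotProduct, Pi.single_apply, apply_ite]
    have hx : (∀ q, x q = false) ↔ x = fun _ => false := funext_iff.symm
    rw [h₀]
    simp only [phaseOp, Finset.mem_univ, true_imp_iff, hx, decide_eq_true_eq, zeroState, ket,
      Pi.sub_apply, Pi.smul_apply, Pi.single_apply, smul_eq_mul]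
    split_ifs with h
    · rw [h]; ring
    · ring
  have hn : star (A (zeroState Q)) ⬝ᵥ A (zeroState Q) = 1 := by
    rw [hA.dotProduct]
    simp [zeroState, ket, dotProduct, Pi.single_apply, apply_ite]
  -- This overlap is `1 - 2 · 1/4`. Reflecting about `|0⟩` therefore subtracts exactly one copy of
  -- `|0⟩`, and applying `A` again cancels `A|0⟩`, leaving `-2χ`.
  have hh : star (zeroState Q) ⬝ᵥ A' (A (zeroState Q) - (2 : ℂ) • χ) = 1 / 2 := by
    rw [hadj, dotProduct_sub, dotProduct_smul, hn, hq]
    norm_num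
  simp only [Function.comp_apply]
  rw [hχ, hR', hh, hA.map_sub, hA.map_smul, hAA']
  norm_num

end basic

/-! ### Biased cat states. -/

section biasedCat

theorem prodState_sum {A B : Type*} [Fintype A] [Fintype B] [DecidableEq A] [DecidableEq B]
    (f : A ⊕ B → Bool → ℂ) (x : A ⊕ B → Bool) :
    prodState f x = (∏ a, f (.inl a) (x (.inl a))) * ∏ b, f (.inr b) (x (.inr b)) :=
  Fintype.prod_sum_type _

theorem prod_ite_eq_bool {A : Type*} [Fintype A] (x : A → Bool) (b : Bool) :
    (∏ a, if x a = b then (1 : ℂ) else 0) = if ∀ a, x a = b then 1 else 0 := by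
  split_ifs with h
  · simp [h]
  · push Not at h
    obtain ⟨a, ha⟩ := h
    exact Finset.prod_eq_zero (Finset.mem_univ a) (if_neg ha)

theorem hGate_mul_self :
    ((√(1 / 2) : ℝ) : ℂ) * ((√(1 / 2) : ℝ) : ℂ) = 1 / 2 := by
  rw [← Complex.ofReal_mul, Real.mul_self_sqrt (by norm_num)]; norm_num

/-- The state `√(1 - p) |0^k⟩|φ₀⟩ - √p |1^k⟩|φ₁⟩` can be prepared exactly in constant depth, for
`p` of order at most `4^{-k}`. -/
theorem exists_impl_biasedCat {k : ℕ} (hk : 2 ≤ k) {p : ℝ} (hp₀ : 0 ≤ p)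
    (hp : p ≤ 16 * ((1 / 2) ^ k) ^ 2) :
    ∃ T : QState (Fin k ⊕ Bool) → QState (Fin k ⊕ Bool), Impl 37 (18 * k + 55) T ∧
      (∀ x, T (zeroState _) x ≠ 0 → ∃ b, ∀ c, x (.inl c) = b) ∧
      ∀ c, ∑ x, (if x (.inl c) then 0 else star (T (zeroState _) x) * T (zeroState _) x) =
        1 - (p : ℂ) := by
  set ε : ℝ := (1 / 2) ^ k with hε
  have hε₀ : 0 < ε := by positivity
  have hε₁ : ε ≤ 1 / 4 := by
    calc ε ≤ (1 / 2) ^ 2 := pow_le_pow_of_le_one (by norm_num) (by norm_num) hk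
      _ = 1 / 4 := by norm_num
  have hp₁ : p ≤ 1 := by nlinarith
  have ha₀ : 0 ≤ (1 - p) / (4 * (1 - 2 * ε) ^ 2) := div_nonneg (by linarith) (by positivity)
  have hc : 0 < 4 * (1 - 2 * ε) ^ 2 := by nlinarith
  have ha₁ : (1 - p) / (4 * (1 - 2 * ε) ^ 2) ≤ 1 := by
    rw [div_le_one hc]
    nlinarith
  have hb₀ : 0 ≤ p / (16 * ε ^ 2) := by positivity
  have hb₁ : p / (16 * ε ^ 2) ≤ 1 := by
    rw [div_le_one (by positivity)]
    exact hp
  -- Before amplification `0^k` has amplitude `1 - 2ε` and `1^k` has `-2ε`. The biases `a` and `b`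
  -- of the two flag qubits reduce their weights to `(1-p)/4` and `p/4`. That `a ≤ 1` uses `ε ≤
  -- 1/4`, hence `k ≥ 2`; that `b ≤ 1` is the assumed bound on `p`.
  set a := (1 - p) / (4 * (1 - 2 * ε) ^ 2) with ha
  set b := p / (16 * ε ^ 2) with hb
  have hac : 4 * (1 - 2 * ε) ^ 2 * a = 1 - p := by
    rw [ha, mul_div_cancel₀ _ hc.ne']
  have hbc : 16 * ε ^ 2 * b = p := by rw [hb]; field_simp
  have ha2 : ((√a : ℝ) : ℂ) * ((√a : ℝ) : ℂ) = a := by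
    rw [← Complex.ofReal_mul, Real.mul_self_sqrt ha₀]
  have ha2' : ((√(1 - a) : ℝ) : ℂ) * ((√(1 - a) : ℝ) : ℂ) = 1 - a := by
    rw [← Complex.ofReal_mul, Real.mul_self_sqrt (by linarith)]; simp
  have hb2 : ((√b : ℝ) : ℂ) * ((√b : ℝ) : ℂ) = b := by
    rw [← Complex.ofReal_mul, Real.mul_self_sqrt hb₀]
  have hb2' : ((√(1 - b) : ℝ) : ℂ) * ((√(1 - b) : ℝ) : ℂ) = 1 - b := by
    rw [← Complex.ofReal_mul, Real.mul_self_sqrt (by linarith)]; simp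
  let Y : Finset (Fin k ⊕ Bool) := Finset.univ.map Function.Embedding.inl
  let r : Bool → Bool → ℂ := fun i x => if i then (if x then (√b : ℝ) else (√(1 - b) : ℝ))
    else (if x then (√a : ℝ) else (√(1 - a) : ℝ))
  -- `F₀` and `F₂` describe `|0^k⟩` and the unnormalized sum of all strings, each with the flags.
  -- `G₀` and `G₁` are the good parts: `0^k` with flag `false` equal to `1`, and `1^k` with flag
  -- `true` equal to `1`.
  let F₀ : Fin k ⊕ Bool → Bool → ℂ := Sum.elim (fun _ x => if x = false then 1 else 0) r
  let F₂ : Fin k ⊕ Bool → Bool → ℂ := Sum.elim (fun _ _ => 1) r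
  let G₀ : Fin k ⊕ Bool → Bool → ℂ := Sum.elim (fun _ x => if x = false then 1 else 0)
    fun i x => if i then r i x else if x then r i x else 0
  let G₁ : Fin k ⊕ Bool → Bool → ℂ := Sum.elim (fun _ x => if x = true then 1 else 0)
    fun i x => if i then (if x then r i x else 0) else r i x
  have hF₀ : ∀ x, prodState F₀ x = if ∀ c, x (.inl c) = false then
      r true (x (.inr true)) * r false (x (.inr false)) else 0 := fun x => by
    rw [prodState_sum]
    simp only [F₀, Sum.elim_inl, Sum.elim_inr, Fintype.prod_bool]
    rw [prod_ite_eq_bool (fun c => x (.inl c)) false]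
    split_ifs <;> simp
  have hF₂ : ∀ x, prodState F₂ x = r true (x (.inr true)) * r false (x (.inr false)) := fun x => by
    rw [prodState_sum]
    simp [F₂]
  have hG₀ : ∀ x, prodState G₀ x = if (∀ c, x (.inl c) = false) ∧ x (.inr false) = true then
      r true (x (.inr true)) * r false (x (.inr false)) else 0 := fun x => by
    rw [prodState_sum]
    simp only [G₀, Sum.elim_inl, Sum.elim_inr, Fintype.prod_bool]
    rw [prod_ite_eq_bool (fun c => x (.inl c)) false]
    by_cases h₁ : ∀ c, x (.inl c) = false <;> by_cases h₂ : x (.inr false) = true <;> simp [h₁, h₂]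
  have hG₁ : ∀ x, prodState G₁ x = if (∀ c, x (.inl c) = true) ∧ x (.inr true) = true then
      r true (x (.inr true)) * r false (x (.inr false)) else 0 := fun x => by
    rw [prodState_sum]
    simp only [G₁, Sum.elim_inl, Sum.elim_inr, Fintype.prod_bool]
    rw [prod_ite_eq_bool (fun c => x (.inl c)) true]
    by_cases h₁ : ∀ c, x (.inl c) = true <;> by_cases h₂ : x (.inr true) = true <;> simp [h₁, h₂]
  have hY : Y.Nonempty := ⟨.inl ⟨0, by omega⟩, by simp [Y]⟩
  let u : Fin k ⊕ Bool → Matrix.unitaryGroup Bool ℂ := Sum.elim (fun _ => hGate) fun _ => 1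
  let u' : Fin k ⊕ Bool → Matrix.unitaryGroup Bool ℂ := Sum.elim (fun _ => hGate)
    fun i => if i then biasGate b hb₀ hb₁ else biasGate a ha₀ ha₁
  have hA := (impl_singleLayer u').comp
    ((impl_phaseOp_pattern hY fun _ => false).comp (impl_singleLayer u))
  -- The two marked patterns exclude each other, so the product of the two sign flips negates
  -- exactly their union.
  have hO := (impl_phaseOp_pattern (Q := Fin k ⊕ Bool) (Finset.insert_nonempty (.inr false) Y)
      (Sum.elim (fun _ => false) fun _ => true)).comp
    (impl_phaseOp_pattern (Finset.insert_nonempty (.inr true) Y) fun _ => true)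
  have hAψ : (singleLayer u' ∘ phaseOp (fun x => decide (∀ q ∈ Y, x q = false)) ∘ singleLayer u)
      (zeroState _) = prodState F₀ - ((2 * ε : ℝ) : ℂ) • prodState F₂ := by
    have h₁ : singleLayer u (zeroState _) =
        prodState (Sum.elim (fun _ _ => ((√(1 / 2) : ℝ) : ℂ)) fun _ x => if x then 0 else 1) := by
      rw [zeroState_eq_prodState, singleLayer_prodState]
      congr 1
      funext q x
      rcases q with q | q <;> cases x <;> simp [u, hGate, reflGate_apply]
    have h₂ : phaseOp (fun x => decide (∀ q ∈ Y, x q = false))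
        (prodState (Sum.elim (fun _ _ => ((√(1 / 2) : ℝ) : ℂ)) fun _ x => if x then 0 else 1)) =
        prodState (Sum.elim (fun _ _ => ((√(1 / 2) : ℝ) : ℂ)) fun _ x => if x then 0 else 1) -
          (2 * ((√(1 / 2) : ℝ) : ℂ) ^ k) • zeroState _ := by
      rw [zeroState_eq_prodState]
      funext x
      have hY' : (∀ q ∈ Y, x q = false) ↔ ∀ c, x (.inl c) = false := by simp [Y]
      have hδ : ∀ b : Bool, (if b = true then (0 : ℂ) else 1) = if b = false then 1 else 0 := by
        intro b; cases b <;> simp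
      simp only [phaseOp, Pi.sub_apply, Pi.smul_apply, prodState_sum, Sum.elim_inl, Sum.elim_inr,
        hY', decide_eq_true_eq, Finset.prod_const, Finset.card_univ, Fintype.card_fin, smul_eq_mul,
        hδ, prod_ite_eq_bool (fun c => x (.inl c)) false]
      split_ifs <;> ring
    simp only [Function.comp_apply]
    rw [h₁, h₂, (impl_singleLayer u').map_sub, (impl_singleLayer u').map_smul,
      zeroState_eq_prodState, singleLayer_prodState, singleLayer_prodState]
    have e₁ : prodState (fun q a => ∑ b, (u' q : Matrix Bool Bool ℂ) a b * (if b then 0 else 1)) =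
        ((√(1 / 2) : ℝ) : ℂ) ^ k • prodState F₂ := by
      funext x
      simp only [Pi.smul_apply, smul_eq_mul, prodState_sum]
      simp [u', F₂, r, hGate, biasGate, reflGate_apply]
    have e₂ : (fun q a => ∑ b, (u' q : Matrix Bool Bool ℂ) a b *
        Sum.elim (fun _ _ => ((√(1 / 2) : ℝ) : ℂ)) (fun _ x => if x then 0 else 1) q b) = F₀ := by
      funext q x
      rcases q with q | (_ | _) <;> cases x <;>
        simp [u', F₀, r, hGate, biasGate, reflGate_apply]
      have h := hGate_mul_self
      simp only [one_div, Real.sqrt_inv, Complex.ofReal_inv] at h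
      linear_combination 2 * h
    rw [e₁, e₂, smul_smul]
    congr 2
    push_cast
    rw [hε, mul_assoc, ← mul_pow, hGate_mul_self]
    simp
  obtain ⟨T, hT, hTχ⟩ := exists_impl_amplify hA hO
    (χ := ((1 - 2 * ε : ℝ) : ℂ) • prodState G₀ - ((2 * ε : ℝ) : ℂ) • prodState G₁) (by
      rw [hAψ]
      funext x
      have e₀ : decide (∀ q ∈ insert (.inr false) Y, x q = Sum.elim (fun _ => false) (fun _ => true) q)
          = decide ((∀ c, x (.inl c) = false) ∧ x (.inr false) = true) := by
        simp [Y, and_comm]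
      have e₁ : decide (∀ q ∈ insert (.inr true) Y, x q = true)
          = decide ((∀ c, x (.inl c) = true) ∧ x (.inr true) = true) := by
        simp [Y, and_comm]
      have h01 : (∀ c, x (.inl c) = false) → ¬ ∀ c, x (.inl c) = true := fun h h' => by
        simpa [h'] using h ⟨0, by omega⟩
      simp only [Function.comp_apply, phaseOp, e₀, e₁, Pi.sub_apply, Pi.smul_apply, hF₀, hF₂, hG₀,
        hG₁, decide_eq_true_eq, smul_eq_mul]
      by_cases h₀ : ∀ c, x (.inl c) = false
      · simp only [eq_true h₀, eq_false (h01 h₀), true_and, false_and, if_true, if_false]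
        split_ifs <;> push_cast <;> ring
      · by_cases h₁ : ∀ c, x (.inl c) = true
        · simp only [eq_false h₀, eq_true h₁, true_and, false_and, if_false]
          split_ifs <;> push_cast <;> ring
        · simp only [eq_false h₀, eq_false h₁, false_and, if_false]
          push_cast; ring) (by
      rw [hAψ]
      simp only [star_sub, star_smul, sub_dotProduct, dotProduct_sub, smul_dotProduct,
        dotProduct_smul, prodState_dotProduct, Fintype.prod_sum_type, Fintype.prod_bool, F₀, F₂,
        G₀, G₁, Sum.elim_inl, Sum.elim_inr, Fintype.sum_bool, r]
      have hac' : 4 * (1 - 2 * (ε : ℂ)) ^ 2 * a = 1 - p := by exact_mod_cast hac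
      have hbc' : 16 * (ε : ℂ) ^ 2 * b = p := by exact_mod_cast hbc
      simp
      rw [ha2, ha2', hb2, hb2', zero_pow (by omega)]
      -- The good weight is `(1-2ε)²a + 4ε²b = (1-p)/4 + p/4`.
      linear_combination (1 / 4) * hac' + (1 / 4) * hbc')
  refine ⟨T, hT.mono (by norm_num) (by simp; omega), ?_, ?_⟩
  · intro x hx
    rw [hTχ] at hx
    simp only [Pi.sub_apply, Pi.smul_apply, hG₀, hG₁] at hx
    by_contra! h
    have h₀ : ¬ ∀ c, x (.inl c) = false := fun h' => (h false).elim fun c hc => hc (h' c)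
    have h₁ : ¬ ∀ c, x (.inl c) = true := fun h' => (h true).elim fun c hc => hc (h' c)
    simp [h₀, h₁] at hx
  · intro c
    have h : ∀ x : Fin k ⊕ Bool → Bool, (if x (.inl c) then 0 else
        star (T (zeroState _) x) * T (zeroState _) x) =
        ((4 * (1 - 2 * ε) ^ 2 : ℝ) : ℂ) * (star (prodState G₀ x) * prodState G₀ x) := by
      intro x
      rw [hTχ]
      simp only [Pi.sub_apply, Pi.smul_apply, smul_eq_mul]
      cases hx : x (.inl c)
      · have : prodState G₁ x = 0 := by
          rw [hG₁, if_neg]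
          rintro ⟨h', -⟩
          simp [h' c] at hx
        simp [this]
        ring
      · have : prodState G₀ x = 0 := by
          rw [hG₀, if_neg]
          rintro ⟨h', -⟩
          simp [h' c] at hx
        simp [this]
    simp only [h]
    rw [← Finset.mul_sum]
    have h' : star (prodState G₀) ⬝ᵥ prodState G₀ = a := by
      simp only [prodState_dotProduct, Fintype.prod_sum_type, Fintype.prod_bool,
        G₀, Sum.elim_inl, Sum.elim_inr, Fintype.sum_bool, r]
      simp
      rw [ha2, hb2, hb2']
      ring
    rw [dotProduct] at h'
    simp only [Pi.star_apply] at h'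
    rw [h', ← Complex.ofReal_mul, hac]
    simp

end biasedCat

/-! ### Balanced nekomata from many biased cat states. -/

section nekomata

/-- The register of a balanced nekomata: `k` target qubits and `m` registers of biased cat states. -/
abbrev NekoReg (k m : ℕ) : Type := Fin k ⊕ Fin m × (Fin k ⊕ Bool)

/-- The qubits of a biased cat state. -/
def catEmb (k m : ℕ) (j : Fin m) : (Fin k ⊕ Bool) ↪ NekoReg k m :=
  ⟨fun q => .inr (j, q), fun q q' h => by simpa using h⟩

/-- A target qubit with the corresponding qubits of the cat states. -/
def targetEmb (k m : ℕ) (c : Fin k) : Option (Fin m) ↪ NekoReg k m :=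
  ⟨fun q => q.elim (.inl c) fun j => .inr (j, .inl c), by
    rintro (_ | j) (_ | j') h <;> simp_all⟩

theorem catEmb_apply (k m : ℕ) (j : Fin m) (q : Fin k ⊕ Bool) : catEmb k m j q = .inr (j, q) := rfl

theorem targetEmb_none (k m : ℕ) (c : Fin k) : targetEmb k m c none = .inl c := rfl

theorem targetEmb_some (k m : ℕ) (c : Fin k) (j : Fin m) :
    targetEmb k m c (some j) = .inr (j, .inl c) := rfl

theorem pairwise_catEmb (k m : ℕ) :
    Pairwise fun i j => ∀ p q, catEmb k m i p ≠ catEmb k m j q := by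
  intro i j h p q h'
  simp only [catEmb_apply, Sum.inr.injEq, Prod.mk.injEq] at h'
  exact h h'.1

theorem pairwise_targetEmb (k m : ℕ) :
    Pairwise fun i j => ∀ p q, targetEmb k m i p ≠ targetEmb k m j q := by
  rintro i j h (_ | p) (_ | q) h' <;> simp [targetEmb_none, targetEmb_some] at h'
  · exact h h'
  · exact h h'.2

/-- Independence of the `m` cat registers, the targets being fixed to `0`. -/
theorem sum_nekoReg {k m : ℕ} (h : (Fin k ⊕ Bool → Bool) → ℂ) :
    ∑ x : NekoReg k m → Bool,
      (∏ j, h (x ∘ catEmb k m j)) * (if ∀ c, x (.inl c) = false then 1 else 0) =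
      (∑ z, h z) ^ m := by
  let e : (Fin k → Bool) × (Fin m → (Fin k ⊕ Bool) → Bool) ≃ (NekoReg k m → Bool) :=
    ((Equiv.refl _).prodCongr (Equiv.curry _ _ _).symm).trans
      (Equiv.sumArrowEquivProdArrow _ _ _).symm
  rw [← e.sum_comp, Fintype.sum_prod_type]
  have h₂ : ∀ t z j, e (t, z) ∘ catEmb k m j = z j := fun t z j => rfl
  have h₃ : ∀ t z c, e (t, z) (.inl c) = t c := fun t z c => rfl
  simp only [h₂, h₃]
  have h₄ : ∀ t : Fin k → Bool, (∀ c, t c = false) ↔ t = fun _ => false := fun t => funext_iff.symm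
  simp only [h₄, mul_ite, mul_one, mul_zero]
  rw [Finset.sum_comm]
  simp only [Finset.sum_ite_eq', Finset.mem_univ, if_true]
  have h₅ := (Finset.prod_univ_sum (fun _ : Fin m => (Finset.univ : Finset (Fin k ⊕ Bool → Bool)))
    (fun _ z => h z)).symm
  rw [Fintype.piFinset_univ] at h₅
  rw [h₅, Finset.prod_const, Finset.card_univ, Fintype.card_fin]

/-- A balanced superposition of states whose target qubits are all `0` and all `1`, respectively,
can be prepared exactly in constant depth. -/
theorem exists_impl_nekomata {k : ℕ} (hk : 2 ≤ k) :
    ∃ U : QState (NekoReg k (4 ^ k)) → QState (NekoReg k (4 ^ k)),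
      Impl 40 (4 ^ k * (20 * k + 55) + 3 * k) U ∧
      (∀ x, U (zeroState _) x ≠ 0 → ∃ b, ∀ c, x (.inl c) = b) ∧
      ∀ c, ∑ x, (if x (.inl c) then star (U (zeroState _) x) * U (zeroState _) x else 0) =
        1 / 2 := by
  set m := 4 ^ k with hm
  have hm₀ : (0 : ℝ) < m := by simp [hm]
  have hlog : 0 ≤ Real.log 2 := Real.log_nonneg (by norm_num)
  have hlog' : Real.log 2 ≤ 1 := by linarith [Real.log_two_lt_d9]
  -- The bias is `p = 1 - 2^(-1/m)`, so that `(1-p)^m = 1/2`. It is at most `1/m = 4^{-k}`, within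
  -- the range allowed for biased cat states.
  have hp₀ : 0 ≤ 1 - Real.exp (-(Real.log 2 / m)) := by
    rw [sub_nonneg, Real.exp_le_one_iff, neg_nonpos]
    positivity
  have hp : 1 - Real.exp (-(Real.log 2 / m)) ≤ 16 * ((1 / 2) ^ k) ^ 2 := by
    have h₁ := Real.add_one_le_exp (-(Real.log 2 / m))
    have h₂ : Real.log 2 / m ≤ 1 / m := by gcongr
    have h₃ : (1 : ℝ) / m = ((1 / 2) ^ k) ^ 2 := by
      rw [hm, ← pow_mul, mul_comm, pow_mul]
      push_cast
      rw [← one_div_pow]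
      norm_num
    have h₄ : (0 : ℝ) ≤ ((1 / 2) ^ k) ^ 2 := by positivity
    linarith
  obtain ⟨T, hT, hT₁, hT₂⟩ := exists_impl_biasedCat hk hp₀ hp
  obtain ⟨F, hF, hF₁, hF₂⟩ := exists_parOp_univ_eq_comp (pairwise_targetEmb k m)
    fun _ => flipFun (norFun Finset.univ)
  have hFi : Function.Involutive F := involutive_of_comp_eq (fun _ => flipFun_involutive _) hF₁ hF₂
  have hU := (Impl.parallel (pairwise_targetEmb k m) fun _ : Fin k =>
      impl_flipFun_nor (Finset.univ : Finset (Fin m))).comp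
    (Impl.parallel (pairwise_catEmb k m) fun _ : Fin m => hT)
  simp only [Fintype.card_fin] at hU
  have hρ : ∀ j y (x : NekoReg k m → Bool),
      (if ∀ c, Function.extend (catEmb k m j) y x (.inl c) = false then (1 : ℂ) else 0) =
        if ∀ c, x (.inl c) = false then 1 else 0 := by
    intro j y x
    have : ∀ c, Function.extend (catEmb k m j) y x (.inl c) = x (.inl c) := fun c =>
      Function.extend_apply' _ _ _ (by rintro ⟨q, hq⟩; simp [catEmb_apply] at hq)
    simp only [this]
  have hΓ := parOp_univ_prod (pairwise_catEmb k m) (fun _ => hT.map_smul)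
    (fun _ => zeroState _)
    (ρ := fun x => if ∀ c, x (.inl c) = false then 1 else 0) hρ
  have h₀ : (fun x : NekoReg k m → Bool => (∏ j, zeroState _ (x ∘ catEmb k m j)) *
      if ∀ c, x (.inl c) = false then (1 : ℂ) else 0) = zeroState _ := by
    funext x
    simp only [zeroState, ket, Pi.single_apply]
    have hx : x = (fun _ => false) ↔
        (∀ j, x ∘ catEmb k m j = fun _ => false) ∧ ∀ c, x (.inl c) = false := by
      constructor
      · rintro rfl
        exact ⟨fun _ => rfl, fun _ => rfl⟩
      · rintro ⟨h, h'⟩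
        funext q
        rcases q with c | ⟨j, q⟩
        · exact h' c
        · exact congrFun (h j) q
    rw [Finset.prod_ite_zero]
    simp only [hx, Finset.mem_univ, true_imp_iff, Finset.prod_const_one, ← ite_and, mul_ite,
      mul_one, mul_zero]
    congr 1
    exact propext and_comm
  rw [h₀] at hΓ
  set Γ : QState (NekoReg k m) := fun x => (∏ j, T (zeroState _) (x ∘ catEmb k m j)) *
      if ∀ c, x (.inl c) = false then (1 : ℂ) else 0 with hΓdef
  refine ⟨_, hU.mono (by norm_num) (le_of_eq (by ring)), ?_, ?_⟩
  · intro x hx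
    simp only [Function.comp_apply, hΓ, hF] at hx
    have h₁ := right_ne_zero_of_mul hx
    have h₂ := Finset.prod_ne_zero_iff.1 (left_ne_zero_of_mul hx)
    simp only [ne_eq, ite_eq_right_iff, one_ne_zero, imp_false, not_not] at h₁
    choose b hb using fun j => hT₁ _ (h₂ j (Finset.mem_univ j))
    -- Every cat register `j` has a common value `b j`, so the NOR written on target `c` does not
    -- depend on `c`.
    refine ⟨decide (∀ j, b j = false), fun c => ?_⟩
    have h₃ := congrFun (hF₁ (F x) c) none
    rw [hFi x] at h₃
    have h₄ : ∀ j, F x (targetEmb k m c (some j)) = b j := fun j => hb j c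
    have h₅ : F x (targetEmb k m c none) = false := h₁ c
    refine Eq.trans h₃ ?_
    simp [flipFun, norFun, Function.comp_def, h₄, h₅]
  · intro c
    simp only [Function.comp_apply, hΓ, hF]
    have hsum := sum_nekoReg (k := k) (m := m) fun z =>
      if z (.inl c) then 0 else star (T (zeroState _) z) * T (zeroState _) z
    have hone : (1 - ((1 - Real.exp (-(Real.log 2 / m)) : ℝ) : ℂ)) ^ m = 1 / 2 := by
      rw [← Complex.ofReal_one, ← Complex.ofReal_sub, ← Complex.ofReal_pow, sub_sub_cancel,
        ← Real.exp_nat_mul, mul_neg, mul_div_cancel₀ _ hm₀.ne', Real.exp_neg,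
        Real.exp_log (by norm_num)]
      norm_num
    rw [hT₂, hone] at hsum
    rw [← hsum]
    -- Reindexing by the involution `F` moves the NORs from the state to the event: target `c`
    -- becomes `1` exactly when the `c`-th qubits of all cat registers are `0`.
    refine (Fintype.sum_equiv hFi.toPerm _ _ fun x => ?_).symm
    change _ = if F x (.inl c) = true then star (Γ (F (F x))) * Γ (F (F x)) else 0
    symm
    rw [hFi x]
    have h₃ : F x (.inl c) = xor (x (.inl c)) (decide (∀ j, x (.inr (j, .inl c)) = false)) := by
      have := congrFun (hF₁ x c) none
      refine Eq.trans this ?_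
      simp [flipFun, norFun, Function.comp_def, targetEmb_none, targetEmb_some]
    rw [h₃, hΓdef]
    by_cases h₁ : ∀ c, x (.inl c) = false
    · simp only [h₁ c, Bool.false_xor, decide_eq_true_eq, if_pos h₁, mul_one]
      by_cases h₂ : ∀ j, x (.inr (j, .inl c)) = false
      · simp [h₂, catEmb_apply, Finset.prod_mul_distrib]
      · have : ∃ j, (x ∘ catEmb k m j) (.inl c) = true := by
          simpa [catEmb_apply] using h₂
        obtain ⟨j, hj⟩ := this
        rw [if_neg h₂]
        refine Eq.symm (Finset.prod_eq_zero (Finset.mem_univ j) ?_)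
        simp only [hj, if_true]
    · simp [if_neg h₁]

end nekomata

/-! ### Copying a bit by means of a balanced state. -/

section copy

variable {R : Type*}

theorem extend_some (y : R → Bool) (x : Option R → Bool) :
    Function.extend (Function.Embedding.some : R ↪ Option R) y x =
      fun q => q.elim (x none) y := by
  funext q
  cases q with
  | none => exact Function.extend_apply' _ _ _ (by simp)
  | some r => exact Function.Embedding.some.injective.extend_apply _ _ _

theorem liftOp_some (T : QState R → QState R) (f : Bool → QState R) :
    liftOp Function.Embedding.some T (fun x : Option R → Bool => f (x none) (x ∘ some)) =
      fun x => T (f (x none)) (x ∘ some) := by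
  funext x
  simp only [liftOp, extend_some]
  rfl

variable [DecidableEq R] [Fintype R]

/-- If `U` prepares a state in which the qubit `q` is balanced, then a circuit maps `|b⟩|0⟩` to a
state supported, up to the first qubit, on strings in the support of that state whose qubit `q` is
`b`. -/
theorem exists_impl_copy_of_balanced {d s : ℕ} {U : QState R → QState R} (hU : Impl d s U) (q : R)
    (hq : ∑ x, (if x q then star (U (zeroState R) x) * U (zeroState R) x else 0) = 1 / 2) :
    ∃ V : QState (Option R) → QState (Option R),
      Impl (3 * d + 9) (3 * s + 4 * Fintype.card R + 9) V ∧
      ∀ b x, V (ket fun r => r.elim b fun _ => false) x ≠ 0 →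
        U (zeroState R) (x ∘ some) ≠ 0 ∧ x (some q) = b := by
  obtain ⟨U', hU', hU'U, hUU', hadj⟩ := hU.exists_adjoint
  have hcard : Fintype.card (Option R) = Fintype.card R + 1 := Fintype.card_option
  -- Read from right to left: `H` on the first qubit, `U`, controlled `Z` onto `q`, `U⁻¹`, a flip of
  -- the first qubit if the register is `0`, and `U`. The states after these steps are `s₁` to `s₆`.
  have hV := (hU.lift .some).comp ((impl_flipFun_nor (Finset.univ : Finset R)).comp ((hU'.lift .some).comp
    ((impl_phaseOp_pattern (Finset.insert_nonempty none {some q}) fun _ => true).comp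
      ((hU.lift .some).comp (Impl.gate (.single none hGate))))))
  refine ⟨_, hV.mono (by omega) (by omega), ?_⟩
  intro b x
  set ν := U (zeroState R) with hν
  let h : Bool → ℂ := fun b' => (hGate : Matrix Bool Bool ℂ) b' b
  let ζ : QState R := fun y => if y q then -ν y else ν y
  -- Here `ζ = Z_q ν`, and balance of `q` says `⟨ν, ζ⟩ = 1 - 2 · 1/2 = 0`. After `U⁻¹` the branches
  -- of `ν` and `ζ` are thus told apart by whether the register is `0`.
  have hζ : U' ζ (fun _ => false) = 0 := by
    have h₁ : star (zeroState R) ⬝ᵥ U' ζ = U' ζ fun _ => false := by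
      simp [zeroState, ket, dotProduct, Pi.single_apply, apply_ite]
    have h₂ : star ν ⬝ᵥ ν = 1 := by
      rw [hν, hU.dotProduct]
      simp [zeroState, ket, dotProduct, Pi.single_apply, apply_ite]
    rw [← h₁, hadj, ← hν]
    have h₃ : star ν ⬝ᵥ ζ = star ν ⬝ᵥ ν - 2 * ∑ x, if x q then star (ν x) * ν x else 0 := by
      simp only [dotProduct, Finset.mul_sum, ← Finset.sum_sub_distrib]
      refine Finset.sum_congr rfl fun x _ => ?_
      simp only [ζ, Pi.star_apply]
      split_ifs <;> ring
    rw [h₃, h₂, hq]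
    norm_num
  have s₁ : (QACGate.single none hGate).app (ket fun r : Option R => r.elim b fun _ => false) =
      fun x => (fun b' => h b' • zeroState R) (x none) (x ∘ some) := by
    funext x
    have hk : ∀ b', ket (fun r : Option R => r.elim b fun _ => false) (Function.update x none b') =
        if b' = b then zeroState R (x ∘ some) else 0 := by
      intro b'
      simp only [ket, zeroState, Pi.single_apply, ← ite_and]
      congr 1
      refine propext ⟨fun h' => ⟨by simpa using congrFun h' none, ?_⟩, ?_⟩
      · funext r
        simpa using congrFun h' (some r)
      · rintro ⟨rfl, h'⟩
        funext r
        cases r with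
        | none => simp
        | some r => simpa using congrFun h' r
    simp only [QACGate.app, hk, mul_ite, mul_zero, Finset.sum_ite_eq', Finset.mem_univ, if_true]
    rfl
  have s₂ : liftOp .some U (fun x => (fun b' => h b' • zeroState R) (x none) (x ∘ some)) =
      fun x => (fun b' => h b' • ν) (x none) (x ∘ some) := by
    refine (liftOp_some U fun b' => h b' • zeroState R).trans ?_
    funext x
    rw [hU.map_smul]
  have s₃ : phaseOp (fun x => decide (∀ r ∈ (insert none {some q} : Finset (Option R)), x r = true))
      (fun x : Option R → Bool => (fun b' => h b' • ν) (x none) (x ∘ some)) =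
      fun x => (fun b' => h b' • if b' then ζ else ν) (x none) (x ∘ some) := by
    funext x
    simp only [phaseOp, Finset.mem_insert, Finset.mem_singleton, forall_eq_or_imp, forall_eq, ζ,
      decide_eq_true_eq, Pi.smul_apply, smul_eq_mul]
    cases x none <;> cases hx : x (some q) <;> simp [hx]
  have s₄ : liftOp .some U' (fun x => (fun b' => h b' • if b' then ζ else ν) (x none) (x ∘ some)) =
      fun x => (fun b' => h b' • if b' then U' ζ else zeroState R) (x none) (x ∘ some) := by
    refine (liftOp_some U' fun b' => h b' • if b' then ζ else ν).trans ?_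
    funext x
    rw [hU'.map_smul]
    cases x none
    · simp only [Bool.false_eq_true, if_false, hν, hU'U]
    · rfl
  -- The NOR turns the first qubit to `1` in the branch of `ν`, where it was `0`, and leaves it `1`
  -- in the branch of `ζ`. It is no longer entangled with the register.
  let f : Bool → QState R := fun b' => if b' then h false • zeroState R + h true • U' ζ else 0
  let g : Bool → QState R := fun b' => if b' then h false • ν + h true • ζ else 0
  have s₅ : (fun x : Option R → Bool =>
        (fun b' => h b' • if b' then U' ζ else zeroState R) (x none) (x ∘ some)) ∘
          flipFun (norFun Finset.univ) =
      fun x => f (x none) (x ∘ some) := by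
    funext x
    simp only [Function.comp_apply, flipFun_comp_some]
    have hx : flipFun (norFun Finset.univ) x none = xor (x none) (norFun Finset.univ (x ∘ some)) :=
      rfl
    rw [hx]
    generalize x ∘ some = y
    by_cases hy : y = fun _ => false
    · subst hy
      cases x none <;> simp [norFun, zeroState, ket, hζ, f]
    · have hn : norFun Finset.univ y = false := by
        simp only [norFun, decide_eq_false_iff_not]
        exact fun h => hy (funext fun r => h r (Finset.mem_univ r))
      cases x none <;> simp [hn, zeroState, ket, hy, f]
  have s₆ : liftOp .some U (fun x => f (x none) (x ∘ some)) = fun x => g (x none) (x ∘ some) := by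
    refine (liftOp_some U f).trans (funext fun x => ?_)
    cases x none
    · have h₀ := hU.map_smul 0 0
      rw [zero_smul, zero_smul] at h₀
      simp only [Bool.false_eq_true, if_false, h₀, f, g]
    · simp only [if_true, hU.map_add, hU.map_smul, hUU', f, g, hν]
  simp only [Function.comp_apply]
  rw [s₁, s₂, s₃, s₄]
  rw [s₅, s₆]
  intro hx
  cases hx' : x none with
  | false => simp [hx', g] at hx
  | true =>
    simp only [hx', if_true, Pi.add_apply, Pi.smul_apply, smul_eq_mul, ζ, g] at hx
    have hh : h = fun b' => (hGate : Matrix Bool Bool ℂ) b' b := rfl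
    refine ⟨fun h₀ => hx (by simp [h₀]), ?_⟩
    by_contra hb
    apply hx
    rw [Function.comp_apply]
    -- The column `b` of the Hadamard gate gives a multiple of `ν + (-1)^b Z_q ν`, which vanishes on
    -- strings whose qubit `q` differs from `b`.
    cases hxq : x (some q) <;> cases b <;>
      simp_all [hGate, reflGate_apply]

end copy

/-! ### The oracle for Hamming weight one. -/

section oracle

/-- The parity of the two `NOR`s of a bit string over the positions with each value of a given binary
digit; all of them are `1` exactly for the strings of Hamming weight one. -/
def digitTest {n : ℕ} (b : ℕ) (y : Fin n → Bool) : Bool :=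
  xor (norFun (Finset.univ.filter fun i : Fin n => (i : ℕ).testBit b = false) y)
    (norFun (Finset.univ.filter fun i : Fin n => (i : ℕ).testBit b = true) y)

/-- For weight zero both NORs are `1`. Two distinct positions holding a `1` differ in one of the `k`
digits, and for it both NORs are `0`. A single `1` makes exactly one of the two NORs fail for every
digit. Positivity of `k` excludes the zero string. -/
theorem forall_digitTest_iff {n k : ℕ} (hk : 0 < k) (hn : n ≤ 2 ^ k) (y : Fin n → Bool) :
    (∀ b : Fin k, digitTest b y = true) ↔ ∃ i, y = fun j => decide (j = i) := by
  constructor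
  · intro h
    have hi : ∃ i, y i = true := by
      by_contra! h'
      have := h ⟨0, hk⟩
      simp [digitTest, norFun, h'] at this
    obtain ⟨i, hi⟩ := hi
    refine ⟨i, funext fun j => ?_⟩
    by_cases hj : j = i
    · subst hj; simp [hi]
    · rw [decide_eq_false hj]
      by_contra hyj
      have hyj' : y j = true := by simpa using hyj
      have hne : (j : ℕ) ≠ i := fun h => hj (Fin.ext h)
      obtain ⟨b, hb⟩ := Nat.exists_testBit_ne_of_ne hne
      have hbk : b < k := by
        by_contra hbk
        have hpow : 2 ^ k ≤ 2 ^ b := Nat.pow_le_pow_right (by norm_num) (not_lt.1 hbk)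
        rw [Nat.testBit_lt_two_pow (by omega), Nat.testBit_lt_two_pow (by omega)] at hb
        exact hb rfl
      have := h ⟨b, hbk⟩
      have h₁ : norFun (Finset.univ.filter fun i : Fin n => (i : ℕ).testBit b = false) y = false := by
        rw [norFun, decide_eq_false_iff_not]
        intro h'
        cases hb' : (i : ℕ).testBit b
        · simpa [hi] using h' i (by simpa using hb')
        · simpa [hyj'] using h' j (by simpa [hb'] using hb)
      have h₂ : norFun (Finset.univ.filter fun i : Fin n => (i : ℕ).testBit b = true) y = false := by
        rw [norFun, decide_eq_false_iff_not]
        intro h'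
        cases hb' : (i : ℕ).testBit b
        · simpa [hyj'] using h' j (by simpa [hb'] using hb)
        · simpa [hi] using h' i (by simpa using hb')
      simp [digitTest, h₁, h₂] at this
  · rintro ⟨i, rfl⟩ b
    have h : ∀ v, norFun (Finset.univ.filter fun j : Fin n => (j : ℕ).testBit b = v)
        (fun j => decide (j = i)) = !decide ((i : ℕ).testBit b = v) := by
      intro v
      rw [norFun, ← decide_not, decide_eq_decide]
      simp only [Finset.mem_filter, Finset.mem_univ, true_and, decide_eq_false_iff_not]
      exact ⟨fun h hv => h i hv rfl, fun h j hj hji => h (hji ▸ hj)⟩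
    rw [digitTest, h, h]
    cases (i : ℕ).testBit b <;> rfl

variable {R : Type*} (n k : ℕ)

/-- The register on which the state `|W⟩` is prepared: its `n` qubits, a register `R` for each of
them, `k` test qubits and a qubit that adjusts the amplitude. -/
abbrev WReg (R : Type*) (n k : ℕ) : Type _ := Fin n ⊕ ((Fin n × R) ⊕ (Fin k ⊕ Unit))

/-- A qubit of the state together with its register. -/
def blockEmb (R : Type*) (n k : ℕ) (i : Fin n) : Option R ↪ WReg R n k :=
  ⟨fun q => q.elim (.inl i) fun r => .inr (.inl (i, r)), by
    rintro (_ | r) (_ | r') h <;> simp_all⟩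

/-- A test qubit together with the qubits it depends on. -/
def testEmb {R : Type*} (n : ℕ) {k : ℕ} (cp : Fin k ↪ R) (b : Fin k) : Option (Fin n) ↪ WReg R n k :=
  ⟨fun q => q.elim (.inr (.inr (.inl b))) fun i => .inr (.inl (i, cp b)), by
    rintro (_ | r) (_ | r') h <;> simp_all⟩

variable {n k}

theorem blockEmb_none (i : Fin n) : blockEmb R n k i none = .inl i := rfl

theorem blockEmb_some (i : Fin n) (r : R) : blockEmb R n k i (some r) = .inr (.inl (i, r)) := rfl

theorem testEmb_none (cp : Fin k ↪ R) (b : Fin k) :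
    testEmb n cp b none = .inr (.inr (.inl b)) := rfl

theorem testEmb_some (cp : Fin k ↪ R) (b : Fin k) (i : Fin n) :
    testEmb n cp b (some i) = .inr (.inl (i, cp b)) := rfl

theorem pairwise_blockEmb :
    Pairwise fun i j => ∀ p q, blockEmb R n k i p ≠ blockEmb R n k j q := by
  rintro i j h (_ | p) (_ | q) h' <;> simp [blockEmb_none, blockEmb_some] at h'
  · exact h h'
  · exact h h'.1

theorem pairwise_testEmb (cp : Fin k ↪ R) :
    Pairwise fun i j => ∀ p q, testEmb n cp i p ≠ testEmb n cp j q := by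
  rintro i j h (_ | p) (_ | q) h' <;> simp [testEmb_none, testEmb_some] at h'
  · exact h h'
  · exact h h'.2

variable [DecidableEq R] [Fintype R]

/-- If a constant-depth circuit `V` copies a bit onto `k` qubits of a register, then the strings of
Hamming weight one can be marked in constant depth. -/
theorem exists_impl_oracle (hk : 0 < k) (hn : n ≤ 2 ^ k) {d s : ℕ} (cp : Fin k ↪ R)
    {V : QState (Option R) → QState (Option R)} (hV : Impl d s V)
    (hV' : ∀ b x, V (ket fun r => r.elim b fun _ => false) x ≠ 0 → ∀ c, x (some (cp c)) = b) :
    ∃ O : QState (WReg R n k) → QState (WReg R n k),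
      Impl (2 * d + 17) (2 * (n * s) + 2 * (k * (4 * n + 6)) +
        (2 * Fintype.card (WReg R n k) + 3)) O ∧
      ∀ x, (∀ q, x (.inr (.inl q)) = false) → (∀ b, x (.inr (.inr (.inl b))) = false) →
        O (ket x) = (if x (.inr (.inr (.inr ()))) = true ∧
          ∃ i, x ∘ Sum.inl = fun j => decide (j = i) then (-1 : ℂ) else 1) • ket x := by
  have hW := Impl.parallel (pairwise_blockEmb (R := R) (n := n) (k := k)) fun _ => hV
  obtain ⟨W', hW', hWW', -, -⟩ := hW.exists_adjoint
  have hflip : ∀ b : Fin k, Impl (3 + 3) (2 * n + 3 + (2 * n + 3))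
      fun ψ : QState (Option (Fin n)) => ψ ∘ flipFun (digitTest b) := by
    intro b
    have h := (impl_flipFun_nor (Finset.univ.filter fun i : Fin n => (i : ℕ).testBit b = true)).comp
      (impl_flipFun_nor (Finset.univ.filter fun i : Fin n => (i : ℕ).testBit b = false))
    rw [Fintype.card_fin] at h
    convert h using 1
    funext ψ x
    simp only [Function.comp_apply, flipFun_flipFun]
    rfl
  obtain ⟨F, hF, hF₁, hF₂⟩ := exists_parOp_univ_eq_comp (pairwise_testEmb (n := n) cp)
    fun b => flipFun (digitTest b)
  have hFi : Function.Involutive F := involutive_of_comp_eq (fun _ => flipFun_involutive _) hF₁ hF₂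
  have hFop := Impl.parallel (pairwise_testEmb (n := n) cp) hflip
  rw [hF] at hFop
  -- The `k` test qubits and the amplitude qubit: the phase demands that all of them be `1`.
  let S : Finset (WReg R n k) :=
    Finset.univ.map (Function.Embedding.inr.trans Function.Embedding.inr)
  have hS : S.Nonempty := ⟨.inr (.inr (.inr ())), by simp [S]⟩
  have hP := hFop.phaseOp_conj hFi (impl_phaseOp_pattern hS fun _ => true)
  simp only [Fintype.card_fin] at hW hW' hP
  refine ⟨_, (hW'.comp (hP.comp hW)).mono (by omega) (by
    rw [show 2 * n + 3 + (2 * n + 3) = 4 * n + 6 by ring]; omega), ?_⟩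
  intro x hx₁ hx₂
  have hρ : ∀ i y (z : WReg R n k → Bool),
      (if ∀ q, Function.extend (blockEmb R n k i) y z (.inr (.inr q)) = x (.inr (.inr q))
        then (1 : ℂ) else 0) = if ∀ q, z (.inr (.inr q)) = x (.inr (.inr q)) then 1 else 0 := by
    intro i y z
    have : ∀ q, Function.extend (blockEmb R n k i) y z (.inr (.inr q)) = z (.inr (.inr q)) :=
      fun q => Function.extend_apply' _ _ _ (by
        rintro ⟨_ | r, hr⟩ <;> simp [blockEmb_none, blockEmb_some] at hr)
    simp only [this]
  have hprod := parOp_univ_prod (pairwise_blockEmb (R := R) (n := n) (k := k))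
    (fun _ => hV.map_smul) (fun i => ket fun r => r.elim (x (.inl i)) fun _ => false)
    (ρ := fun z => if ∀ q, z (.inr (.inr q)) = x (.inr (.inr q)) then 1 else 0) hρ
  have hket : (fun z : WReg R n k → Bool =>
      (∏ i, ket (fun r : Option R => r.elim (x (.inl i)) fun _ => false) (z ∘ blockEmb R n k i)) *
      if ∀ q, z (.inr (.inr q)) = x (.inr (.inr q)) then (1 : ℂ) else 0) = ket x := by
    funext z
    simp only [ket, Pi.single_apply]
    have hz : z = x ↔ (∀ i, z ∘ blockEmb R n k i = fun r => r.elim (x (.inl i)) fun _ => false) ∧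
        ∀ q, z (.inr (.inr q)) = x (.inr (.inr q)) := by
      constructor
      · rintro rfl
        refine ⟨fun i => funext fun r => ?_, fun _ => rfl⟩
        cases r with
        | none => rfl
        | some r => exact hx₁ (i, r)
      · rintro ⟨h, h'⟩
        funext q
        rcases q with i | ⟨i, r⟩ | q
        · exact congrFun (h i) none
        · rw [hx₁]
          exact congrFun (h i) (some r)
        · exact h' q
    rw [Finset.prod_ite_zero]
    simp only [hz, Finset.mem_univ, true_imp_iff, Finset.prod_const_one, ← ite_and, mul_ite,
      mul_one, mul_zero]
    congr 1
    exact propext and_comm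
  rw [hket] at hprod
  set Ψ := parOp Finset.univ.toList (blockEmb R n k) (fun _ => V) (ket x) with hΨ
  set σ : ℂ := if x (.inr (.inr (.inr ()))) = true ∧
    ∃ i, x ∘ Sum.inl = fun j => decide (j = i) then (-1 : ℂ) else 1 with hσ
  -- All strings in the support of `Ψ` carry the same copied bits, so the tests give the same
  -- answers on all of them and the phase is one scalar. The inverse of the copying circuit then
  -- restores `ket x`.
  have hphase : phaseOp ((fun x => decide (∀ q ∈ S, x q = true)) ∘ F) Ψ = σ • Ψ := by
    funext z
    by_cases hz : Ψ z = 0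
    · simp [phaseOp, hz]
    · have hz' := hz
      rw [hprod] at hz'
      have h₁ := right_ne_zero_of_mul hz'
      have h₂ := Finset.prod_ne_zero_iff.1 (left_ne_zero_of_mul hz')
      simp only [ne_eq, ite_eq_right_iff, one_ne_zero, imp_false, not_not] at h₁
      have hcp : ∀ i c, z (.inr (.inl (i, cp c))) = x (.inl i) := fun i =>
        hV' _ _ (h₂ i (Finset.mem_univ i))
      have ht : ∀ b, F z (.inr (.inr (.inl b))) = digitTest b (x ∘ Sum.inl) := by
        intro b
        refine (congrFun (hF₁ z b) none).trans ?_
        have h₃ : (z ∘ testEmb n cp b) ∘ some = x ∘ Sum.inl := funext fun i => hcp i b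
        have h₄ : (z ∘ testEmb n cp b) none = false := (h₁ (.inl b)).trans (hx₂ b)
        simp only [flipFun, h₃, h₄, Bool.false_xor]
      have hr : F z (.inr (.inr (.inr ()))) = x (.inr (.inr (.inr ()))) := by
        rw [hF₂, h₁]
        rintro b (_ | i) <;> simp [testEmb_none, testEmb_some]
      have hg : (∀ q ∈ S, F z q = true) ↔ x (.inr (.inr (.inr ()))) = true ∧
          ∃ i, x ∘ Sum.inl = fun j => decide (j = i) := by
        rw [← forall_digitTest_iff hk hn]
        rw [← hr]
        simp only [← ht, S, Finset.forall_mem_map, Finset.mem_univ, forall_true_left]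
        refine ⟨fun h => ⟨h (.inr ()), fun b => h (.inl b)⟩, fun h q => ?_⟩
        rcases q with b | _
        exacts [h.2 b, h.1]
      simp only [phaseOp, Function.comp_apply, hg, decide_eq_true_eq, hσ, Pi.smul_apply,
        smul_eq_mul]
      split_ifs <;> simp
  simp only [Function.comp_apply]
  rw [← hΨ, hphase, hW'.map_smul, hΨ, hWW']

end oracle

/-! ### Preparation of the W state. -/

section main

/-- With `n = m + 1` the right side is the inverse of `(1 + 1/m)^m ≤ e < 4`; for `n = 1` it is `0^0
= 1`. -/
theorem one_sub_inv_pow_ge {n : ℕ} (hn : 1 ≤ n) : (1 / 4 : ℝ) ≤ (1 - 1 / n) ^ (n - 1) := by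
  obtain ⟨m, rfl⟩ : ∃ m, n = m + 1 := ⟨n - 1, by omega⟩
  rcases Nat.eq_zero_or_pos m with rfl | hm
  · norm_num
  · have hm' : (0 : ℝ) < m := by exact_mod_cast hm
    have h₁ : (1 + 1 / (m : ℝ)) ^ m ≤ 4 := by
      calc (1 + 1 / (m : ℝ)) ^ m ≤ Real.exp (1 / m) ^ m := by
            gcongr
            linarith [Real.add_one_le_exp (1 / (m : ℝ))]
        _ = Real.exp 1 := by rw [← Real.exp_nat_mul, mul_one_div_cancel hm'.ne']
        _ ≤ 4 := by linarith [Real.exp_one_lt_d9]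
    have h₂ : (1 - 1 / ((m + 1 : ℕ) : ℝ)) = (1 + 1 / (m : ℝ))⁻¹ := by
      push_cast
      field_simp
      ring
    rw [h₂, Nat.add_sub_cancel, inv_pow, one_div]
    exact inv_anti₀ (by positivity) h₁

variable {R : Type*} [DecidableEq R] [Fintype R]

/-- The string with the qubit `i` of the state and the amplitude qubit in the state `1`. -/
def markedString (R : Type*) (n k : ℕ) (i : Fin n) : WReg R n k → Bool :=
  Sum.elim (fun j => decide (j = i)) (Sum.elim (fun _ => false) (Sum.elim (fun _ => false)
    fun _ => true))

omit [DecidableEq R] [Fintype R] in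
theorem markedString_injective (n k : ℕ) : Function.Injective (markedString R n k) := by
  intro i j h
  simpa [markedString] using congrFun h (.inl i)

/-- Amplitude amplification of the weight-one part of a product of qubits with bias `1/n`, using the
oracle built from `V`. -/
theorem exists_impl_wState {n k : ℕ} (hn : 1 ≤ n) (hk : 0 < k) (hnk : n ≤ 2 ^ k) {d s : ℕ}
    (cp : Fin k ↪ R) {V : QState (Option R) → QState (Option R)} (hV : Impl d s V)
    (hV' : ∀ b x, V (ket fun r => r.elim b fun _ => false) x ≠ 0 → ∀ c, x (some (cp c)) = b) :
    ∃ T : QState (WReg R n k) → QState (WReg R n k),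
      Impl (2 * d + 27) (2 * (n * s) + 2 * (k * (4 * n + 6)) +
        7 * Fintype.card (WReg R n k) + 8) T ∧
      T (zeroState _) = tensorState (wState n) (zeroState _) := by
  obtain ⟨O, hO, hO'⟩ := exists_impl_oracle hk hnk cp hV hV'
  have hn₀ : (0 : ℝ) < n := by exact_mod_cast hn
  have hp₀ : (0 : ℝ) ≤ 1 / n := by positivity
  have hp₁ : (1 : ℝ) / n ≤ 1 := by
    rw [div_le_one hn₀]
    exact_mod_cast hn
  set B : ℝ := (1 - 1 / n) ^ (n - 1) with hB
  have hB₁ : 1 / 4 ≤ B := one_sub_inv_pow_ge hn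
  have hB₀ : 0 < B := by linarith
  have hr₀ : 0 ≤ 1 / (4 * B) := by positivity
  have hr₁ : 1 / (4 * B) ≤ 1 := by
    rw [div_le_one (by positivity)]
    linarith
  let u : WReg R n k → Matrix.unitaryGroup Bool ℂ :=
    Sum.elim (fun _ => biasGate (1 / n) hp₀ hp₁) (Sum.elim (fun _ => 1) (Sum.elim (fun _ => 1)
      fun _ => biasGate (1 / (4 * B)) hr₀ hr₁))
  let f : WReg R n k → Bool → ℂ :=
    Sum.elim (fun _ b => if b then (√(1 / n) : ℝ) else (√(1 - 1 / n) : ℝ))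
      (Sum.elim (fun _ b => if b then 0 else 1) (Sum.elim (fun _ b => if b then 0 else 1)
        fun _ b => if b then (√(1 / (4 * B)) : ℝ) else (√(1 - 1 / (4 * B)) : ℝ)))
  have hψ : singleLayer u (zeroState _) = prodState f := by
    rw [zeroState_eq_prodState, singleLayer_prodState]
    congr 1
    funext q b
    rcases q with q | q | q | q <;> cases b <;> simp [u, f, biasGate, reflGate_apply]
  -- The common amplitude of the `n` marked strings. The bias `1/(4B)` of the last qubit brings
  -- their total weight from `B` to `1/4`, so `c² = 1/(4n)` and amplification doubles `c` to `1/√n`.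
  set c : ℝ := √(1 / n) * √(1 - 1 / n) ^ (n - 1) * √(1 / (4 * B)) with hc
  have hc₀ : 0 ≤ c := by positivity
  have hc₂ : c * c = 1 / (4 * n) := by
    have e₁ : √(1 / (n : ℝ)) * √(1 / (n : ℝ)) = 1 / n := Real.mul_self_sqrt hp₀
    have e₂ : √(1 - 1 / (n : ℝ)) * √(1 - 1 / (n : ℝ)) = 1 - 1 / n :=
      Real.mul_self_sqrt (sub_nonneg.2 hp₁)
    have e₃ : √(1 / (4 * B)) * √(1 / (4 * B)) = 1 / (4 * B) := Real.mul_self_sqrt hr₀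
    calc c * c = (√(1 / (n : ℝ)) * √(1 / (n : ℝ))) *
          (√(1 - 1 / (n : ℝ)) * √(1 - 1 / (n : ℝ))) ^ (n - 1) *
          (√(1 / (4 * B)) * √(1 / (4 * B))) := by rw [hc, mul_pow]; ring
      _ = 1 / n * B * (1 / (4 * B)) := by rw [e₁, e₂, e₃]
      _ = 1 / (4 * n) := by field_simp
  have hc2 : 2 * c = (√n)⁻¹ := by
    rw [← Real.sqrt_inv, eq_comm, Real.sqrt_eq_iff_mul_self_eq (by positivity) (by positivity)]
    rw [show 2 * c * (2 * c) = 4 * (c * c) by ring, hc₂]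
    field_simp
  have hfc : ∀ i, prodState f (markedString R n k i) = c := by
    intro i
    rw [prodState_sum, Fintype.prod_sum_type, Fintype.prod_sum_type,
      ← Finset.mul_prod_erase _ _ (Finset.mem_univ i)]
    have h : ∀ j ∈ Finset.univ.erase i, f (.inl j) (markedString R n k i (.inl j)) =
        (√(1 - 1 / n) : ℝ) := fun j hj => by
      simp only [f, markedString, Sum.elim_inl, decide_eq_true_eq, if_neg (Finset.ne_of_mem_erase hj)]
    rw [Finset.prod_congr rfl h, Finset.prod_const, Finset.card_erase_of_mem (Finset.mem_univ i),
      Finset.card_univ, Fintype.card_fin, hc]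
    simp [f, markedString]
  have hanc : ∀ x, prodState f x ≠ 0 → (∀ q, x (.inr (.inl q)) = false) ∧
      ∀ b, x (.inr (.inr (.inl b))) = false := by
    intro x hx
    have h := Finset.prod_ne_zero_iff.1 hx
    constructor
    · intro q
      simpa [f] using h (.inr (.inl q)) (Finset.mem_univ _)
    · intro b
      simpa [f] using h (.inr (.inr (.inl b))) (Finset.mem_univ _)
  let χ : QState (WReg R n k) := (c : ℂ) • ∑ i, ket (markedString R n k i)
  have hχ : O (prodState f) = prodState f - (2 : ℂ) • χ := by
    have hsum : prodState f = ∑ x, prodState f x • ket x := by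
      funext y
      simp [ket, Pi.single_apply]
    let σ : (WReg R n k → Bool) → ℂ := fun x => if x (.inr (.inr (.inr ()))) = true ∧
      ∃ i, x ∘ Sum.inl = fun j => decide (j = i) then (-1 : ℂ) else 1
    have hOsum : O (prodState f) = ∑ x, (prodState f x * σ x) • ket x := by
      conv_lhs => rw [hsum]
      rw [hO.map_sum]
      refine Finset.sum_congr rfl fun x _ => ?_
      rw [hO.map_smul]
      by_cases hx : prodState f x = 0
      · simp [hx]
      · rw [hO' x (hanc x hx).1 (hanc x hx).2, smul_smul]
    rw [hOsum]
    funext y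
    have hy : (∑ x, (prodState f x * σ x) • ket x) y = prodState f y * σ y := by
      simp [ket, Pi.single_apply]
    rw [hy]
    simp only [Pi.sub_apply, Pi.smul_apply, χ, Finset.sum_apply, smul_eq_mul]
    by_cases h : ∃ i, y = markedString R n k i
    · obtain ⟨i, rfl⟩ := h
      have hσ : σ (markedString R n k i) = -1 := if_pos ⟨rfl, i, rfl⟩
      have hk : ∑ j, ket (markedString R n k j) (markedString R n k i) = 1 := by
        simp [ket, Pi.single_apply, (markedString_injective n k).eq_iff]
      rw [hσ, hk, hfc]
      ring
    · have hk : ∑ j, ket (markedString R n k j) y = 0 := by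
        refine Finset.sum_eq_zero fun j _ => ?_
        rw [ket, Pi.single_apply, if_neg fun hj => h ⟨j, hj⟩]
      rw [hk]
      by_cases hy₀ : prodState f y = 0
      · simp [hy₀]
      · have hσ : σ y = 1 := by
          refine if_neg ?_
          rintro ⟨hr, i, hi⟩
          refine h ⟨i, funext fun q => ?_⟩
          rcases q with q | q | q | q
          · exact congrFun hi q
          · exact (hanc y hy₀).1 q
          · exact (hanc y hy₀).2 q
          · exact hr
        rw [hσ]
        ring
  have hq : star (prodState f) ⬝ᵥ χ = 1 / 4 := by
    have h : ∀ i, star (prodState f) ⬝ᵥ ket (markedString R n k i) = c := fun i => by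
      simp only [ket, dotProduct_single, Pi.star_apply, hfc]
      simp
    have hc₂' : (c : ℂ) * c = 1 / (4 * n) := by
      rw [← Complex.ofReal_mul, hc₂]
      push_cast
      rfl
    simp only [χ, dotProduct_smul, dotProduct_sum, h, Finset.sum_const, Finset.card_univ,
      Fintype.card_fin, smul_eq_mul, nsmul_eq_mul]
    rw [mul_left_comm, hc₂']
    have : (n : ℂ) ≠ 0 := by exact_mod_cast hn₀.ne'
    field_simp
  obtain ⟨T, hT, hTχ⟩ := exists_impl_amplify (Q := WReg R n k) (impl_singleLayer u) hO
    (χ := χ) (by rw [hψ, hχ]) (by rw [hψ, hq])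
  -- After amplification the amplitude qubit is `1` in every term; a final `X` resets it.
  refine ⟨_, ((Impl.gate (.single (.inr (.inr (.inr ()))) xGate)).comp hT).mono (by omega)
    (by omega), ?_⟩
  rw [Function.comp_apply, hTχ, xGate_app]
  funext x
  have hterm : ∀ i, ket (markedString R n k i)
      (Function.update x (.inr (.inr (.inr ()))) (!x (.inr (.inr (.inr ()))))) =
      ket (fun j => decide (j = i)) (fun j => x (.inl j)) * zeroState _ (fun q => x (.inr q)) := by
    intro i
    simp only [ket, zeroState, Pi.single_apply, mul_ite, mul_one, mul_zero, ← ite_and]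
    congr 1
    refine propext ⟨fun h => ⟨?_, ?_⟩, ?_⟩
    · funext q
      rcases q with q | q | q
      · simpa [markedString] using congrFun h (.inr (.inl q))
      · simpa [markedString] using congrFun h (.inr (.inr (.inl q)))
      · simpa [markedString] using congrFun h (.inr (.inr (.inr q)))
    · funext q
      simpa [markedString] using congrFun h (.inl q)
    · rintro ⟨h₁, h₂⟩
      funext q
      rcases q with q | q | q | q
      · simpa [markedString] using congrFun h₂ q
      · simpa [markedString] using congrFun h₁ (.inl q)
      · simpa [markedString] using congrFun h₁ (.inr (.inl q))
      · have := congrFun h₁ (.inr (.inr q))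
        simp [markedString, this]
  simp only [χ, Pi.smul_apply, Finset.sum_apply, hterm, tensorState, wState, smul_eq_mul,
    ← Finset.sum_mul]
  rw [← hc2]
  push_cast
  ring

theorem Impl.exists_circuit {n : ℕ} {A : Type*} [DecidableEq A] [Fintype A] {d s : ℕ}
    {T : QState (Fin n ⊕ A) → QState (Fin n ⊕ A)} (hT : Impl d s T) {ψ : QState (Fin n)}
    (h : T (zeroState _) = tensorState ψ (zeroState _)) :
    ∃ U : QACCircuit (Fin n ⊕ Fin (Fintype.card A)),
      U.depth = d ∧ U.size ≤ s + (n + Fintype.card A) ∧ U.Prepares ψ := by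
  let e : Fin n ⊕ A ≃ Fin n ⊕ Fin (Fintype.card A) :=
    (Equiv.refl _).sumCongr (Fintype.equivFin A)
  obtain ⟨Ls, hl, hs, hp, -, hLs⟩ := hT.lift e.toEmbedding
  -- `Ls` has the layer applied last in front, whereas a `QACCircuit` lists its layers in order of
  -- application.
  refine ⟨⟨(Ls.pmap QACLayer.mk hp).reverse⟩, ?_, ?_, ?_⟩
  · simp [QACCircuit.depth, hl]
  · simp only [QACCircuit.size, List.map_reverse, List.sum_reverse, List.map_pmap,
      Fintype.card_sum, Fintype.card_fin]
    rw [List.pmap_eq_map]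
    omega
  · have hm : QACCircuit.matrix ⟨(Ls.pmap QACLayer.mk hp).reverse⟩ = layersMatrix Ls := by
      simp only [QACCircuit.matrix, List.reverse_reverse, List.map_pmap, QACLayer.matrix]
      rw [List.pmap_eq_map]
      rfl
    have hz : ∀ (y : Fin n ⊕ A → Bool) x, Function.extend e.toEmbedding y x = y ∘ e.symm := by
      intro y x
      funext q
      obtain ⟨p, rfl⟩ := e.surjective q
      simp
    have h₀ : tensorState (zeroState (Fin n)) (zeroState (Fin (Fintype.card A))) = zeroState _ := by
      funext x
      simp only [tensorState, zeroState, ket, Pi.single_apply, mul_ite, mul_one, mul_zero, ← ite_and,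
        funext_iff, Sum.forall]
      congr 1
      exact propext and_comm
    rw [QACCircuit.Prepares, hm, h₀]
    refine (congrFun hLs _).symm.trans ?_
    funext x
    have h₁ : (fun y : Fin n ⊕ A → Bool => zeroState (Fin n ⊕ Fin (Fintype.card A)) (y ∘ e.symm)) =
        zeroState _ := by
      funext y
      simp only [zeroState, ket, Pi.single_apply]
      congr 1
      refine propext ⟨fun h => ?_, ?_⟩
      · funext q
        simpa using congrFun h (e q)
      · rintro rfl
        rfl
    simp only [liftOp, hz, h₁, h, tensorState]
    congr 1
    simp only [zeroState, ket, Pi.single_apply]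
    congr 1
    refine propext ⟨fun h => ?_, fun h => ?_⟩
    · funext q
      obtain ⟨p, rfl⟩ := (Fintype.equivFin A).surjective q
      exact congrFun h p
    · funext q
      exact congrFun h (Fintype.equivFin A q)

end main

/-! ### Choice of parameters. -/

theorem theorem1p5 :
    ∃ (d : ℕ) (p : Polynomial ℕ), ∀ n : ℕ, 1 ≤ n →
      ∃ (a : ℕ) (U : QACCircuit (Fin n ⊕ Fin a)),
        a ≤ p.eval n ∧ U.depth ≤ d ∧ U.size ≤ p.eval n ∧ U.Prepares (wState n) := by
  let card : ℕ → ℕ → ℕ → ℕ := fun n k m => n * (k + m * (k + 2)) + (k + 1)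
  let copySize : ℕ → ℕ → ℕ := fun k m =>
    3 * (m * (20 * k + 55) + 3 * k) + 4 * (k + m * (k + 2)) + 9
  let size : ℕ → ℕ → ℕ → ℕ := fun n k m =>
    2 * (n * copySize k m) + 2 * (k * (4 * n + 6)) + 7 * (n + card n k m) + 8 + (n + card n k m)
  -- The expansion of `size n (4 * n) (16 * n ^ 2)`, from the bounds `k ≤ 4n` and `4^k ≤ 16n²`.
  let p : Polynomial ℕ := 8704 * Polynomial.X ^ 4 + 5792 * Polynomial.X ^ 3 +
    168 * Polynomial.X ^ 2 + 106 * Polynomial.X + 16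
  -- The nekomata has depth `40`, the copying circuit `3 · 40 + 9 = 129`, and the whole circuit `2 ·
  -- 129 + 27 = 285`.
  refine ⟨285, p, fun n hn => ?_⟩
  -- The summand `2` ensures both `k ≥ 2`, needed for cat states, and `n ≤ 2^k`, while keeping `2^k
  -- ≤ 4n`.
  set k := Nat.log 2 n + 2 with hk
  have hk₂ : 2 ≤ k := by omega
  have hnk : n ≤ 2 ^ k := by
    have := Nat.lt_pow_succ_log_self (b := 2) (by norm_num) n
    have h' : 2 ^ (Nat.log 2 n).succ ≤ 2 ^ k := Nat.pow_le_pow_right (by norm_num) (by omega)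
    omega
  have hkn : 2 ^ k ≤ 4 * n := by
    have := Nat.pow_log_le_self 2 (x := n) (by omega)
    rw [hk, pow_add]
    omega
  have hkn' : k ≤ 4 * n := (Nat.lt_two_pow_self).le.trans hkn
  have hm : 4 ^ k ≤ 16 * n ^ 2 := by
    calc 4 ^ k = (2 ^ k) ^ 2 := by rw [← pow_mul, mul_comm, pow_mul]; norm_num
      _ ≤ (4 * n) ^ 2 := Nat.pow_le_pow_left hkn 2
      _ = 16 * n ^ 2 := by ring
  have hp : size n k (4 ^ k) ≤ p.eval n := by
    calc size n k (4 ^ k) ≤ size n (4 * n) (16 * n ^ 2) := by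
          simp only [size, copySize, card]
          gcongr
      _ = p.eval n := by
          simp [p, size, copySize, card]
          ring
  obtain ⟨U, hU, hU₁, hU₂⟩ := exists_impl_nekomata hk₂
  obtain ⟨V, hV, hV'⟩ := exists_impl_copy_of_balanced hU (.inl ⟨0, by omega⟩) (hU₂ _)
  obtain ⟨T, hT, hT'⟩ := exists_impl_wState hn (by omega) hnk Function.Embedding.inl hV
    fun b x hx c => by
      obtain ⟨h₁, h₂⟩ := hV' b x hx
      obtain ⟨b', hb'⟩ := hU₁ _ h₁
      rw [← h₂]
      exact (hb' c).trans (hb' _).symm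
  obtain ⟨C, hC, hC', hC''⟩ := hT.exists_circuit hT'
  have hcard : Fintype.card (Fin n × NekoReg k (4 ^ k) ⊕ (Fin k ⊕ Unit)) = card n k (4 ^ k) := by
    simp [card]
  have hC' : C.size ≤ size n k (4 ^ k) := hC'.trans (le_of_eq (by
    simp [size, copySize, card]))
  refine ⟨_, C, ?_, hC.le, hC'.trans hp, hC''⟩
  rw [hcard]
  exact le_trans (by simp only [size]; omega) hp
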